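/- Let $H$ be a complex Hilbert space and let $J$ be a JW-algebra on $H$: a real linear space of bounded self-adjoint operators on $H$ that is closed under the Jordan product $a\circ b=\tfrac12(ab+ba)$, closed in the weak operator topology, and contains a unit, denoted $1$. Let $\mathcal E(J)=\{a\in J: 0\le a\le 1\}$. It is an effect algebra, in which $a\oplus b$ is defined iff $a+b\in\mathcal E(J)$, and then $a\oplus b=a+b$. A map $\tau:\mathcal E(J)\to\mathcal E(J)$ is called unital additive if $\tau(1)=1$ and $\tau(a+b)=\tau(a)+\tau(b)$ whenever $a,b,a+b\in\mathcal E(J)$. A unital additive map $\tau$ is called * a state operator if $\tau(\tau(a))=\tau(a)$ for all $a$; * a Jordan state operator if $\tau(a^2)=\tau(\tau(a)^2)$ for all $a$; * a conditional expectation if $\tau(\tau(a)b\tau(a))=\tau(a)\tau(b)\tau(a)$ for all $a,b$; * faithful if $\tau(a)=0$ implies $a=0$; * normal if $a_\alpha\nearrow a$ implies $\tau(a_\alpha)\nearrow\tau(a)$ for every ascending net $(a_\alpha)$ in $\mathcal E(J)$ with supremum $a$ in $\mathcal E(J)$. A subset $F\subseteq\mathcal E(J)$ is called a sub-JW-effect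 algebra of $\mathcal E(J)$ if it contains $1$, is closed under $a\mapsto 1-a$, under those sums $a+b$ that lie in $\mathcal E(J)$, and under squares, and $F=\mathcal E(N)$ for a JW-algebra $N\subseteq J$ with the same unit as $J$. All of the above notions then apply to maps $F\to F$. Theorem. Let $\tau:\mathcal E(J)\to\mathcal E(J)$ be a normal state operator. Then: (i) $\mathcal E_\tau:=\{a\in\mathcal E(J): \tau(a^2)=\tau(\tau(a)^2)\}$ is a sub-JW-effect algebra of $\mathcal E(J)$; (ii) there is a faithful normal conditional expectation $\mu:\mathcal E(J)\to\mathcal E(J)$ with range $\mathcal E_\tau$; (iii) there is a normal Jordan state operator $\phi:\mathcal E_\tau\to\mathcal E_\tau$ such that $\tau=\phi\circ\mu$. -/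

import Mathlib

/-- A (unital) JW-algebra on the complex Hilbert space `H`: a real vector space of bounded
self-adjoint operators that is closed under the Jordan product `a ∘ b = (ab + ba)/2` and closed in
the weak operator topology, together with its unit, an element `unit` with `unit ∘ a = a` for all
`a`. The unit is unique; it need not be the identity operator of `H`. -/
structure JWAlgebra (H : Type*) [NormedAddCommGroup H] [InnerProductSpace ℂ H] [CompleteSpace H]
    extends Submodule ℝ (H →L[ℂ] H) where
  isSelfAdjoint' : ∀ a ∈ carrier, IsSelfAdjoint a
  jordan_mem' : ∀ a ∈ carrier, ∀ b ∈ carrier, (1 / 2 : ℝ) • (a * b + b * a) ∈ carrier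
  isClosed_wot' : IsClosed {x : H →WOT[ℂ] H | x.toCLM ∈ carrier}
  unit : H →L[ℂ] H
  unit_mem' : unit ∈ carrier
  unit_jordan' : ∀ a ∈ carrier, (1 / 2 : ℝ) • (unit * a + a * unit) = a

namespace JWAlgebra

variable {H : Type*} [NormedAddCommGroup H] [InnerProductSpace ℂ H] [CompleteSpace H]

/-- The effects of `J`: the elements `a` of `J` with `0 ≤ a ≤ 1` in the usual (Loewner) order of
operators. The partial sum `a ⊕ b` of effects is defined iff `a + b` is again an effect, and then
`a ⊕ b = a + b`; the order of the effect algebra is the Loewner order. -/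
def effects (J : JWAlgebra H) : Set (H →L[ℂ] H) :=
  {a | a ∈ J.toSubmodule ∧ 0 ≤ a ∧ a ≤ 1}

/-- The JW-effect algebra `E(J)`, as a type, ordered as a subset of the operators on `H`. -/
abbrev Effect (J : JWAlgebra H) : Type _ := ↥J.effects

variable (J : JWAlgebra H)

theorem unit_mul_self : J.unit * J.unit = J.unit := by
  have h := J.unit_jordan' _ J.unit_mem'
  rwa [← two_smul ℝ, smul_smul, show (1 / 2 : ℝ) * 2 = 1 by norm_num, one_smul] at h

theorem unit_mem_effects : J.unit ∈ J.effects := by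
  have hp : IsStarProjection J.unit := ⟨J.unit_mul_self, J.isSelfAdjoint' _ J.unit_mem'⟩
  exact ⟨J.unit_mem', hp.nonneg, hp.le_one⟩

theorem conj_mem_effects {a b : H →L[ℂ] H} (ha : a ∈ J.effects) (hb : b ∈ J.effects) :
    a * b * a ∈ J.effects := by
  obtain ⟨haJ, ha0, ha1⟩ := ha
  obtain ⟨hbJ, hb0, hb1⟩ := hb
  have hpos : 0 ≤ a * b * a := by
    have := star_left_conjugate_nonneg hb0 a
    rwa [(J.isSelfAdjoint' a haJ).star_eq] at this
  refine ⟨?_, hpos, ?_⟩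
  · have h1 := J.jordan_mem' _ (J.jordan_mem' a haJ b hbJ) a haJ
    have h2 := J.jordan_mem' _ (J.jordan_mem' a haJ a haJ) b hbJ
    have h3 := J.toSubmodule.sub_mem (J.toSubmodule.smul_mem (2 : ℝ) h1) h2
    convert h3 using 1
    simp only [smul_mul_assoc, mul_smul_comm, smul_add, add_mul, mul_add, mul_assoc, smul_smul]
    module
  · have hna := (CStarAlgebra.norm_le_one_iff_of_nonneg a ha0).2 ha1
    have hnb := (CStarAlgebra.norm_le_one_iff_of_nonneg b hb0).2 hb1
    refine (CStarAlgebra.norm_le_one_iff_of_nonneg _ hpos).1 ?_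
    calc ‖a * b * a‖ ≤ ‖a‖ * ‖b‖ * ‖a‖ :=
          (norm_mul_le _ _).trans (by gcongr; exact norm_mul_le _ _)
      _ ≤ 1 * 1 * 1 := by gcongr
      _ = 1 := by norm_num

theorem sq_mem_effects {a : H →L[ℂ] H} (ha : a ∈ J.effects) : a ^ 2 ∈ J.effects := by
  obtain ⟨haJ, ha0, ha1⟩ := ha
  have hpos : 0 ≤ a ^ 2 := by
    have := star_mul_self_nonneg a
    rwa [(J.isSelfAdjoint' a haJ).star_eq, ← pow_two] at this
  refine ⟨?_, hpos, ?_⟩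
  · have h1 := J.jordan_mem' a haJ a haJ
    rwa [← two_smul ℝ, smul_smul, show (1 / 2 : ℝ) * 2 = 1 by norm_num, one_smul,
      ← pow_two] at h1
  · have hna := (CStarAlgebra.norm_le_one_iff_of_nonneg a ha0).2 ha1
    refine (CStarAlgebra.norm_le_one_iff_of_nonneg _ hpos).1 ?_
    calc ‖a ^ 2‖ ≤ ‖a‖ * ‖a‖ := by rw [pow_two]; exact norm_mul_le _ _
      _ ≤ 1 * 1 := by gcongr
      _ = 1 := by norm_num

/-- The unit of the effect algebra `E(J)`. -/
def one : J.Effect := ⟨J.unit, J.unit_mem_effects⟩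

variable {J}

/-- The effect `a²`. -/
def sq (a : J.Effect) : J.Effect := ⟨(a : H →L[ℂ] H) ^ 2, J.sq_mem_effects a.2⟩

/-- The effect `aba`. -/
def conj (a b : J.Effect) : J.Effect :=
  ⟨(a : H →L[ℂ] H) * b * a, J.conj_mem_effects a.2 b.2⟩

/-- `τ` is unital and additive on `E(J)`: `τ(1) = 1`, and `τ(a ⊕ b) = τ(a) ⊕ τ(b)` whenever
`a ⊕ b` is defined (the relation `c = a + b` between effects says that `a ⊕ b` is defined and
equals `c`). -/
structure IsUnitalAdditive (τ : J.Effect → J.Effect) : Prop where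
  map_one : τ J.one = J.one
  map_add : ∀ a b c : J.Effect, (c : H →L[ℂ] H) = a + b →
    (τ c : H →L[ℂ] H) = τ a + τ b

/-- A state operator: a unital, additive and idempotent map. -/
structure IsStateOperator (τ : J.Effect → J.Effect) : Prop extends IsUnitalAdditive τ where
  idem : ∀ a, τ (τ a) = τ a

/-- A Jordan state operator: a unital additive map with `φ(a²) = φ(φ(a)²)`. -/
structure IsJordanStateOperator (φ : J.Effect → J.Effect) : Prop extends IsUnitalAdditive φ where
  map_sq : ∀ a, φ (sq a) = φ (sq (φ a))

/-- A conditional expectation: a unital additive map with `μ(μ(a) b μ(a)) = μ(a) μ(b) μ(a)`. -/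
structure IsConditionalExpectation (μ : J.Effect → J.Effect) : Prop
    extends IsUnitalAdditive μ where
  map_conj : ∀ a b, μ (conj (μ a) b) = conj (μ a) (μ b)

/-- `τ` is faithful: `τ(a) = 0` implies `a = 0`. -/
def IsFaithful (τ : J.Effect → J.Effect) : Prop :=
  ∀ a, (τ a : H →L[ℂ] H) = 0 → (a : H →L[ℂ] H) = 0

/-- `τ` is normal: for every nonempty upward directed set `D` of effects with supremum `a` in
`E(J)`, the supremum of `τ(D)` in `E(J)` is `τ(a)`. -/
def IsNormal (τ : J.Effect → J.Effect) : Prop :=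
  ∀ D : Set J.Effect, D.Nonempty → DirectedOn (· ≤ ·) D →
    ∀ a, IsLUB D a → IsLUB (τ '' D) (τ a)

/-- `F` is a subeffect algebra of `E(J)`: it contains `1`, and is closed under orthosupplements
and under existing sums. -/
structure IsSubEffectAlgebra (F : Set J.Effect) : Prop where
  one_mem : J.one ∈ F
  compl_mem : ∀ a b : J.Effect, (a : H →L[ℂ] H) + b = J.unit → a ∈ F → b ∈ F
  add_mem : ∀ a b c : J.Effect, (c : H →L[ℂ] H) = a + b → a ∈ F → b ∈ F → c ∈ F

/-- `N` is a JW-subalgebra of `J` with the same unit, and `F` is its effect algebra `E(N)`. -/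
def IsEffectsOf (F : Set J.Effect) (N : JWAlgebra H) : Prop :=
  N.toSubmodule ≤ J.toSubmodule ∧ N.unit = J.unit ∧
    ∀ a : J.Effect, a ∈ F ↔ (a : H →L[ℂ] H) ∈ N.effects

/-- `F` is a sub-JW-effect algebra of `E(J)`: a subeffect algebra that is closed under squares and
is itself a JW-effect algebra, that is, the set of all effects of a JW-subalgebra of `J` with the
same unit. -/
structure IsSubJWEffectAlgebra (F : Set J.Effect) : Prop extends IsSubEffectAlgebra F where
  sq_mem : ∀ a ∈ F, sq a ∈ F
  exists_jw : ∃ N : JWAlgebra H, IsEffectsOf F N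

/-- The set `E_τ` of all effects `a` with `τ(a²) = τ(τ(a)²)`. -/
def eqSet (τ : J.Effect → J.Effect) : Set J.Effect :=
  {a | τ (sq a) = τ (sq (τ a))}

end JWAlgebra

/-! Additivity and positivity make `τ` homogeneous, so it extends to a normal positive unital
idempotent linear map T on J (`exists_linear_extension`). By normality there is a largest projection
p with T(p) = 0 (`exists_isNullProjection`). Put e = 1 - p, where 1 is the unit of J, and M(a) = e
T(a) e + p a p (`faithfulPart`). This M serves as μ, and T restricted to the fixed points of M
serves as φ.

Kadison's inequality T(a)² ≤ T(a²) (`map_mul_self_le`) drives the algebra. A Cauchy-Schwarz argument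
shows that T kills p x + x p and p x p, so T(e x e) = T(x) and therefore T ∘ M = T. The latter makes
M idempotent and, with the choice of p, faithful. Fixed points of T commute with p
(`mul_comm_of_fixed`), hence are fixed by M. For a faithful positive idempotent, equality must hold
in Kadison's inequality at a fixed point a. The fixed points are therefore closed under squares, and
M(a x + x a) = a M(x) + M(x) a, from which M(a x a) = a M(x) a follows.

With b = T(a) one has M(a) - b = p (a - b) p, so M(a) = a says that a - b lives in the corner of p,
which amounts to T((a - b)²) = 0 and, after expansion, to T(a²) = T(b²). Thus `eqSet τ` consists of
the effects fixed by M (`faithfulPart_eq_self_iff`), and the same equation says that φ is a Jordan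
state operator.

It remains to see that the fixed points are weak operator closed. Normality only yields a norm
closed Jordan algebra N closed under suprema of directed sets of effects. Such an N is weak operator
closed (`isClosed_wot`): every projection of the closure lies in N
(`projection_mem_of_mem_wotClosure`), and every effect of the closure is a norm limit of dyadic
combinations of its projections (`exists_projection_half`). -/

section Preliminaries

open Filter Topology ContinuousLinearMap
open scoped InnerProductSpace

set_option linter.unusedSectionVars false

/-! ### Order and strong convergence of bounded operators -/

section Operators

variable {H : Type*} [NormedAddCommGroup H] [InnerProductSpace ℂ H] [CompleteSpace H]

namespace ContinuousLinearMap

theorem reApplyInnerSelf_mono {a b : H →L[ℂ] H} (h : a ≤ b) (x : H) :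
    a.reApplyInnerSelf x ≤ b.reApplyInnerSelf x := by
  have := h.re_inner_nonneg_left x
  simpa [reApplyInnerSelf_apply, inner_sub_left] using this

theorem le_of_reApplyInnerSelf_le {a b : H →L[ℂ] H} (hab : IsSelfAdjoint (b - a))
    (h : ∀ x, a.reApplyInnerSelf x ≤ b.reApplyInnerSelf x) : a ≤ b := by
  refine (isPositive_def' (T := b - a)).2 ⟨hab, fun x => ?_⟩
  have := h x
  simpa [reApplyInnerSelf_apply, inner_sub_left] using this

theorem isSelfAdjoint_sub_of_le {a b : H →L[ℂ] H} (h : a ≤ b) : IsSelfAdjoint (b - a) :=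
  (sub_nonneg.2 h).isSelfAdjoint

theorem isSelfAdjoint_of_tendsto {ι : Type*} {l : Filter ι} [l.NeBot] {f : ι → H →L[ℂ] H}
    {s : H →L[ℂ] H} (hf : ∀ᶠ i in l, IsSelfAdjoint (f i))
    (h : ∀ x, Tendsto (fun i => f i x) l (𝓝 (s x))) : IsSelfAdjoint s := by
  rw [isSelfAdjoint_iff_isSymmetric]
  intro x y
  refine tendsto_nhds_unique ((h x).inner tendsto_const_nhds)
    ((tendsto_const_nhds.inner (h y)).congr' ?_)
  filter_upwards [hf] with i hi
  exact ((isSelfAdjoint_iff_isSymmetric.1 hi) x y).symm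

theorem tendsto_reApplyInnerSelf {ι : Type*} {l : Filter ι} {f : ι → H →L[ℂ] H}
    {s : H →L[ℂ] H} (h : ∀ x, Tendsto (fun i => f i x) l (𝓝 (s x))) (x : H) :
    Tendsto (fun i => (f i).reApplyInnerSelf x) l (𝓝 (s.reApplyInnerSelf x)) :=
  (RCLike.continuous_re.tendsto _).comp ((h x).inner tendsto_const_nhds)

theorem le_of_tendsto_apply {ι : Type*} {l : Filter ι} [l.NeBot] {f : ι → H →L[ℂ] H}
    {s a : H →L[ℂ] H} (hf : ∀ᶠ i in l, f i ≤ a)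
    (h : ∀ x, Tendsto (fun i => f i x) l (𝓝 (s x))) : s ≤ a := by
  refine le_of_reApplyInnerSelf_le ?_ fun x => ?_
  · refine isSelfAdjoint_of_tendsto (l := l) (f := fun i => a - f i) ?_ ?_
    · filter_upwards [hf] with i hi using isSelfAdjoint_sub_of_le hi
    · exact fun x => tendsto_const_nhds.sub (h x)
  · refine le_of_tendsto (tendsto_reApplyInnerSelf h x) ?_
    filter_upwards [hf] with i hi using reApplyInnerSelf_mono hi x

theorem ge_of_tendsto_apply {ι : Type*} {l : Filter ι} [l.NeBot] {f : ι → H →L[ℂ] H}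
    {s a : H →L[ℂ] H} (hf : ∀ᶠ i in l, a ≤ f i)
    (h : ∀ x, Tendsto (fun i => f i x) l (𝓝 (s x))) : a ≤ s := by
  have := le_of_tendsto_apply (f := fun i => - f i) (s := -s) (a := -a) (l := l) ?_ ?_
  · simpa using this
  · filter_upwards [hf] with i hi using neg_le_neg hi
  · exact fun x => (h x).neg

theorem isLUB_range_of_tendsto_apply {ι : Type*} [Preorder ι] [IsDirectedOrder ι] [Nonempty ι]
    {f : ι → H →L[ℂ] H} (hf : Monotone f) {s : H →L[ℂ] H}
    (h : ∀ x, Tendsto (fun i => f i x) atTop (𝓝 (s x))) : IsLUB (Set.range f) s := by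
  constructor
  · rintro _ ⟨i, rfl⟩
    refine ge_of_tendsto_apply (l := atTop) ?_ h
    filter_upwards [eventually_ge_atTop i] with j hj using hf hj
  · intro b hb
    exact le_of_tendsto_apply (l := atTop) (Eventually.of_forall fun i => hb ⟨i, rfl⟩) h

theorem mul_self_le_self {a : H →L[ℂ] H} (h0 : 0 ≤ a) (h1 : a ≤ 1) : a * a ≤ a := by
  have : 0 ≤ a * (1 - a) :=
    Commute.mul_nonneg h0 (sub_nonneg.2 h1) ((Commute.one_right a).sub_right (Commute.refl a))
  rw [mul_sub, mul_one] at this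
  exact sub_nonneg.1 this

theorem reApplyInnerSelf_mul_self {a : H →L[ℂ] H} (ha : IsSelfAdjoint a) (x : H) :
    (a * a).reApplyInnerSelf x = ‖a x‖ ^ 2 := by
  have h := (isSelfAdjoint_iff_isSymmetric.1 ha) (a x) x
  simp only [coe_coe] at h
  rw [reApplyInnerSelf_apply, mul_def, comp_apply, h, inner_self_eq_norm_sq]

/-- Since a² ≤ a for an effect, the quadratic form controls the norm. This turns convergence of
quadratic forms into strong convergence. -/
theorem norm_apply_sq_le {a : H →L[ℂ] H} (h0 : 0 ≤ a) (h1 : a ≤ 1) (x : H) :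
    ‖a x‖ ^ 2 ≤ a.reApplyInnerSelf x := by
  rw [← reApplyInnerSelf_mul_self h0.isSelfAdjoint]
  exact reApplyInnerSelf_mono (mul_self_le_self h0 h1) x

theorem norm_apply_le_of_effect {a : H →L[ℂ] H} (h0 : 0 ≤ a) (h1 : a ≤ 1) (x : H) :
    ‖a x‖ ≤ ‖x‖ := by
  have := (CStarAlgebra.norm_le_one_iff_of_nonneg a h0).2 h1
  simpa using a.le_of_opNorm_le this x

/-- A monotone net of operators between `0` and `1` converges strongly to its supremum. -/
theorem exists_isLUB_range_tendsto {ι : Type*} [Preorder ι] [IsDirectedOrder ι] [Nonempty ι]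
    {f : ι → H →L[ℂ] H} (hf : Monotone f) (h0 : ∀ i, 0 ≤ f i) (h1 : ∀ i, f i ≤ 1) :
    ∃ s, IsLUB (Set.range f) s ∧ ∀ x, Tendsto (fun i => f i x) atTop (𝓝 (s x)) := by
  have key : ∀ x, ∃ y, Tendsto (fun i => f i x) atTop (𝓝 y) := by
    intro x
    rw [← cauchy_map_iff_exists_tendsto]
    have hmono : Monotone fun i => (f i).reApplyInnerSelf x :=
      fun i j hij => reApplyInnerSelf_mono (hf hij) x
    have hbdd : BddAbove (Set.range fun i => (f i).reApplyInnerSelf x) := by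
      refine ⟨(1 : H →L[ℂ] H).reApplyInnerSelf x, ?_⟩
      rintro _ ⟨i, rfl⟩
      exact reApplyInnerSelf_mono (h1 i) x
    have hc := (tendsto_atTop_ciSup hmono hbdd).cauchy_map
    rw [Metric.cauchy_iff] at hc ⊢
    refine ⟨inferInstance, fun ε hε => ?_⟩
    -- The tolerance is squared because f j - f i is an effect d, and ‖d x‖² is bounded by the
    -- increment of the quadratic form.
    obtain ⟨t, ht, hdist⟩ := hc.2 ((ε / 2) ^ 2) (by positivity)
    obtain ⟨i, hi⟩ := mem_atTop_sets.1 (mem_map.1 ht)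
    have hdiff : ∀ j, i ≤ j → ‖f j x - f i x‖ < ε / 2 := by
      intro j hij
      have h0' : 0 ≤ f j - f i := sub_nonneg.2 (hf hij)
      have h1' : f j - f i ≤ 1 := (sub_le_self _ (h0 i)).trans (h1 j)
      have h2 := norm_apply_sq_le h0' h1' x
      have h3 := hdist _ (hi j hij) _ (hi i le_rfl)
      have h4 : (f j - f i).reApplyInnerSelf x
          = (f j).reApplyInnerSelf x - (f i).reApplyInnerSelf x := by
        simp [reApplyInnerSelf_apply, inner_sub_left]
      rw [Real.dist_eq] at h3
      have h5 := (le_abs_self _).trans_lt h3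
      rw [← h4] at h5
      exact lt_of_pow_lt_pow_left₀ 2 (by positivity) (h2.trans_lt h5)
    refine ⟨(fun j => f j x) '' Set.Ici i, mem_map.2 ?_, ?_⟩
    · filter_upwards [mem_atTop i] with j hj using ⟨j, hj, rfl⟩
    · rintro _ ⟨j, hj, rfl⟩ _ ⟨k, hk, rfl⟩
      calc dist (f j x) (f k x) ≤ dist (f j x) (f i x) + dist (f k x) (f i x) :=
            dist_triangle_right _ _ _
        _ < ε / 2 + ε / 2 := by
            rw [dist_eq_norm, dist_eq_norm]
            exact add_lt_add (hdiff j hj) (hdiff k hk)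
        _ = ε := by ring
  choose g hg using key
  let L : H →ₗ[ℂ] H := linearMapOfTendsto g (fun i => (f i : H →ₗ[ℂ] H)) (l := atTop)
    (tendsto_pi_nhds.2 hg)
  have hL : ∀ x, ‖L x‖ ≤ 1 * ‖x‖ := by
    intro x
    rw [one_mul]
    exact le_of_tendsto (hg x).norm
      (Eventually.of_forall fun i => norm_apply_le_of_effect (h0 i) (h1 i) x)
  have hs : ∀ x, Tendsto (fun i => f i x) atTop (𝓝 (L.mkContinuous 1 hL x)) := hg
  exact ⟨L.mkContinuous 1 hL, isLUB_range_of_tendsto_apply hf hs, hs⟩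

theorem tendsto_apply_of_isLUB_range {ι : Type*} [Preorder ι] [IsDirectedOrder ι] [Nonempty ι]
    {f : ι → H →L[ℂ] H} (hf : Monotone f) (h0 : ∀ i, 0 ≤ f i) (h1 : ∀ i, f i ≤ 1)
    {s : H →L[ℂ] H} (hs : IsLUB (Set.range f) s) (x : H) :
    Tendsto (fun i => f i x) atTop (𝓝 (s x)) := by
  obtain ⟨t, ht, h⟩ := exists_isLUB_range_tendsto hf h0 h1
  rw [hs.unique ht]
  exact h x

theorem _root_.DirectedOn.isDirectedOrder_coe {α : Type*} [Preorder α] {D : Set α}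
    (h : DirectedOn (· ≤ ·) D) : IsDirectedOrder D :=
  ⟨fun a b => by
    obtain ⟨c, hc, hac, hbc⟩ := h a a.2 b b.2
    exact ⟨⟨c, hc⟩, hac, hbc⟩⟩

theorem exists_isLUB_tendsto {D : Set (H →L[ℂ] H)} (hne : D.Nonempty)
    (hD : DirectedOn (· ≤ ·) D) (h01 : ∀ d ∈ D, 0 ≤ d ∧ d ≤ 1) :
    ∃ s, IsLUB D s ∧ ∀ x, Tendsto (fun d : D => (d : H →L[ℂ] H) x) atTop (𝓝 (s x)) := by
  have := hD.isDirectedOrder_coe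
  have := hne.to_subtype
  obtain ⟨s, hs, h⟩ := exists_isLUB_range_tendsto (f := ((↑) : D → H →L[ℂ] H))
    (Subtype.mono_coe _) (fun d => (h01 d d.2).1) (fun d => (h01 d d.2).2)
  exact ⟨s, by simpa using hs, h⟩

theorem tendsto_apply_of_isLUB {D : Set (H →L[ℂ] H)} (hne : D.Nonempty)
    (hD : DirectedOn (· ≤ ·) D) (h01 : ∀ d ∈ D, 0 ≤ d ∧ d ≤ 1) {s : H →L[ℂ] H}
    (hs : IsLUB D s) (x : H) :
    Tendsto (fun d : D => (d : H →L[ℂ] H) x) atTop (𝓝 (s x)) := by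
  obtain ⟨t, ht, h⟩ := exists_isLUB_tendsto hne hD h01
  rw [hs.unique ht]
  exact h x

theorem isLUB_image_of_tendsto_apply {D : Set (H →L[ℂ] H)} (hne : D.Nonempty)
    (hD : DirectedOn (· ≤ ·) D) {F : (H →L[ℂ] H) → H →L[ℂ] H} (hF : MonotoneOn F D)
    {s : H →L[ℂ] H}
    (h : ∀ x, Tendsto (fun d : D => F d x) atTop (𝓝 (s x))) : IsLUB (F '' D) s := by
  have := hD.isDirectedOrder_coe
  have := hne.to_subtype
  rw [Set.image_eq_range]
  exact isLUB_range_of_tendsto_apply (f := fun d : D => F d) (fun a b hab => hF a.2 b.2 hab) h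

theorem tendsto_apply_of_isLUB_image {D : Set (H →L[ℂ] H)} (hne : D.Nonempty)
    (hD : DirectedOn (· ≤ ·) D) {F : (H →L[ℂ] H) → H →L[ℂ] H} (hF : MonotoneOn F D)
    (h01 : ∀ d ∈ D, 0 ≤ F d ∧ F d ≤ 1) {s : H →L[ℂ] H} (hs : IsLUB (F '' D) s) (x : H) :
    Tendsto (fun d : D => F d x) atTop (𝓝 (s x)) := by
  have := hD.isDirectedOrder_coe
  have := hne.to_subtype
  rw [Set.image_eq_range] at hs
  exact tendsto_apply_of_isLUB_range (f := fun d : D => F d) (fun a b hab => hF a.2 b.2 hab)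
    (fun d => (h01 d d.2).1) (fun d => (h01 d d.2).2) hs x

theorem apply_eq_zero_of_le {a b : H →L[ℂ] H} (h0 : 0 ≤ a) (h1 : a ≤ 1) (hab : a ≤ b) {x : H}
    (hx : b x = 0) : a x = 0 := by
  have h2 := (norm_apply_sq_le h0 h1 x).trans (reApplyInnerSelf_mono hab x)
  rw [reApplyInnerSelf_apply, hx, inner_zero_left, map_zero] at h2
  have : ‖a x‖ = 0 := by nlinarith [norm_nonneg (a x)]
  exact norm_eq_zero.1 this

theorem mul_eq_self_of_le_smul {a p : H →L[ℂ] H} (h0 : 0 ≤ a) (h1 : a ≤ 1)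
    (hp : IsStarProjection p) {c : ℝ} (h : a ≤ c • p) : a * p = a ∧ p * a = a := by
  have h2 : a * p = a := by
    ext x
    have : a (x - p x) = 0 := by
      refine apply_eq_zero_of_le h0 h1 h ?_
      have hpp : p (p x) = p x := congrArg (fun T : H →L[ℂ] H => T x) hp.isIdempotentElem
      simp [hpp]
    rw [map_sub, sub_eq_zero] at this
    exact this.symm
  refine ⟨h2, ?_⟩
  have := congrArg star h2
  rwa [star_mul, h0.isSelfAdjoint.star_eq, hp.isSelfAdjoint.star_eq] at this

/-- The size of c is irrelevant: the bound only serves to give a = p a p, and compressing a ≤ 1 by p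
does the rest. -/
theorem le_of_le_smul {a p : H →L[ℂ] H} (h0 : 0 ≤ a) (h1 : a ≤ 1)
    (hp : IsStarProjection p) {c : ℝ} (h : a ≤ c • p) : a ≤ p := by
  obtain ⟨h2, h3⟩ := mul_eq_self_of_le_smul h0 h1 hp h
  have h4 := star_left_conjugate_le_conjugate h1 p
  rwa [hp.isSelfAdjoint.star_eq, h3, h2, mul_one, hp.isIdempotentElem.eq] at h4

end ContinuousLinearMap

end Operators

/-! ### Monotone closed Jordan algebras and their projections -/

section MonotoneClosed

variable {H : Type*} [NormedAddCommGroup H] [InnerProductSpace ℂ H] [CompleteSpace H]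

/-- The elements of `N` between `0` and `1`. -/
def effectsIn (N : Submodule ℝ (H →L[ℂ] H)) : Set (H →L[ℂ] H) :=
  {a | a ∈ N ∧ 0 ≤ a ∧ a ≤ 1}

/-- A norm closed Jordan algebra `N` of self-adjoint operators with unit `u` that contains the
suprema of its upward directed sets of effects. -/
structure IsMonotoneClosedJordan (N : Submodule ℝ (H →L[ℂ] H)) (u : H →L[ℂ] H) : Prop where
  isSelfAdjoint : ∀ a ∈ N, IsSelfAdjoint a
  sq_mem : ∀ a ∈ N, a * a ∈ N
  isClosed : IsClosed (N : Set (H →L[ℂ] H))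
  unit_mem : u ∈ N
  unit_mul : ∀ a ∈ N, u * a = a
  sup_mem : ∀ D ⊆ effectsIn N, D.Nonempty → DirectedOn (· ≤ ·) D → ∀ s, IsLUB D s → s ∈ N

namespace IsMonotoneClosedJordan

variable {N : Submodule ℝ (H →L[ℂ] H)} {u : H →L[ℂ] H} (hN : IsMonotoneClosedJordan N u)
include hN

theorem mul_unit {a : H →L[ℂ] H} (ha : a ∈ N) : a * u = a := by
  have := congrArg star (hN.unit_mul a ha)
  rwa [star_mul, (hN.isSelfAdjoint a ha).star_eq, (hN.isSelfAdjoint u hN.unit_mem).star_eq]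
    at this

theorem isStarProjection_unit : IsStarProjection u :=
  ⟨hN.unit_mul u hN.unit_mem, hN.isSelfAdjoint u hN.unit_mem⟩

theorem unit_mem_effectsIn : u ∈ effectsIn N :=
  ⟨hN.unit_mem, hN.isStarProjection_unit.nonneg, hN.isStarProjection_unit.le_one⟩

theorem mul_add_mul_mem {a b : H →L[ℂ] H} (ha : a ∈ N) (hb : b ∈ N) : a * b + b * a ∈ N := by
  have h := N.sub_mem (N.sub_mem (hN.sq_mem _ (N.add_mem ha hb)) (hN.sq_mem _ ha))
    (hN.sq_mem _ hb)
  convert h using 1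
  noncomm_ring

theorem mul_mem_of_commute {a b : H →L[ℂ] H} (ha : a ∈ N) (hb : b ∈ N) (h : Commute a b) :
    a * b ∈ N := by
  have h1 := N.smul_mem (1 / 2 : ℝ) (hN.mul_add_mul_mem ha hb)
  rw [← h.eq, ← two_smul ℝ, smul_smul] at h1
  norm_num at h1
  exact h1

theorem conj_mem {a b : H →L[ℂ] H} (ha : a ∈ N) (hb : b ∈ N) : a * b * a ∈ N := by
  have h1 := hN.mul_add_mul_mem ha (hN.mul_add_mul_mem ha hb)
  have h2 := hN.mul_add_mul_mem (hN.sq_mem _ ha) hb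
  have h3 := N.smul_mem (1 / 2 : ℝ) (N.sub_mem h1 h2)
  convert h3 using 1
  have : a * (a * b + b * a) + (a * b + b * a) * a - (a * a * b + b * (a * a))
      = (2 : ℝ) • (a * b * a) := by
    rw [two_smul]
    noncomm_ring
  rw [this, smul_smul]
  norm_num

theorem le_unit {a : H →L[ℂ] H} (ha : a ∈ N) (h1 : a ≤ 1) : a ≤ u := by
  have h4 := star_left_conjugate_le_conjugate h1 u
  rwa [(hN.isSelfAdjoint u hN.unit_mem).star_eq, hN.unit_mul a ha, hN.mul_unit ha, mul_one,
    hN.unit_mul u hN.unit_mem] at h4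

theorem unit_sub_mem {a : H →L[ℂ] H} (ha : a ∈ effectsIn N) : u - a ∈ effectsIn N :=
  ⟨N.sub_mem hN.unit_mem ha.1, sub_nonneg.2 (hN.le_unit ha.1 ha.2.2),
    (sub_le_self _ ha.2.1).trans hN.unit_mem_effectsIn.2.2⟩

theorem le_norm_smul_unit {a : H →L[ℂ] H} (ha : a ∈ N) : a ≤ ‖a‖ • u := by
  have h := star_left_conjugate_le_conjugate (hN.isSelfAdjoint a ha).le_algebraMap_norm_self u
  rwa [(hN.isSelfAdjoint u hN.unit_mem).star_eq, hN.unit_mul a ha, hN.mul_unit ha,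
    Algebra.algebraMap_eq_smul_one, mul_smul_comm, mul_one, smul_mul_assoc,
    hN.unit_mul u hN.unit_mem] at h

/-- The identity operator need not lie in N, but it cancels: the expression is a polynomial in y
without constant term. -/
theorem one_sub_one_sub_pow_mem {y : H →L[ℂ] H} (hy : y ∈ N) (n : ℕ) :
    1 - (1 - y) ^ n ∈ N := by
  induction n with
  | zero => simp
  | succ n ih =>
    have hc : Commute (1 - (1 - y) ^ n) y :=
      (Commute.one_left y).sub_left (((Commute.one_left y).sub_left (Commute.refl y)).pow_left n)
    have h := N.sub_mem (N.add_mem ih hy) (hN.mul_mem_of_commute ih hy hc)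
    convert h using 1
    rw [pow_succ]
    noncomm_ring

/-- This p is the range projection of y, reached from below by 1 - (1 - y)ⁿ. The bound by n y
matters later: it keeps each approximant in any class of effects that is hereditary up to multiples.
-/
theorem exists_projection_isLUB {y : H →L[ℂ] H} (hy : y ∈ effectsIn N) :
    ∃ p, IsStarProjection p ∧ p ∈ N ∧ y ≤ p ∧ Monotone (fun n : ℕ => 1 - (1 - y) ^ n) ∧
      (∀ n : ℕ, 1 - (1 - y) ^ n ∈ effectsIn N ∧ 1 - (1 - y) ^ n ≤ (n : ℝ) • y) ∧
      IsLUB (Set.range fun n : ℕ => 1 - (1 - y) ^ n) p := by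
  obtain ⟨hyN, hy0, hy1⟩ := hy
  have hz0 : 0 ≤ 1 - y := sub_nonneg.2 hy1
  have hcz : Commute (1 - y) y := (Commute.one_left y).sub_left (Commute.refl y)
  have hzn : ∀ n : ℕ, 0 ≤ (1 - y) ^ n := fun n => by
    induction n with
    | zero => simp
    | succ n ih =>
      rw [pow_succ]
      exact Commute.mul_nonneg ih hz0 ((Commute.refl _).pow_left n)
  have hstep : ∀ n : ℕ, (1 - y) ^ n - (1 - y) ^ (n + 1) = (1 - y) ^ n * y := fun n => by
    rw [pow_succ]
    noncomm_ring
  have hmono : Monotone (fun n : ℕ => 1 - (1 - y) ^ n) := by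
    refine monotone_nat_of_le_succ fun n => sub_le_sub_left (sub_nonneg.1 ?_) _
    rw [hstep]
    exact Commute.mul_nonneg (hzn n) hy0 (hcz.pow_left n)
  have h01 : ∀ n : ℕ, 0 ≤ 1 - (1 - y) ^ n ∧ 1 - (1 - y) ^ n ≤ 1 := fun n =>
    ⟨by simpa using hmono (Nat.zero_le n), sub_le_self _ (hzn n)⟩
  have hle : ∀ n : ℕ, 1 - (1 - y) ^ n ≤ (n : ℝ) • y := fun n => by
    induction n with
    | zero => simp
    | succ n ih =>
      have h1 : 0 ≤ (1 - (1 - y) ^ n) * y :=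
        Commute.mul_nonneg (h01 n).1 hy0 ((Commute.one_left y).sub_left (hcz.pow_left n))
      have h2 : 1 - (1 - y) ^ (n + 1) = 1 - (1 - y) ^ n + (y - (1 - (1 - y) ^ n) * y) := by
        rw [pow_succ]
        noncomm_ring
      rw [h2, Nat.cast_succ, add_smul, one_smul]
      exact add_le_add ih (sub_le_self _ h1)
  obtain ⟨p, hp, hlim⟩ := exists_isLUB_range_tendsto hmono (fun n => (h01 n).1) (fun n => (h01 n).2)
  have hmem : ∀ n : ℕ, 1 - (1 - y) ^ n ∈ effectsIn N := fun n =>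
    ⟨hN.one_sub_one_sub_pow_mem hyN n, h01 n⟩
  have hpN : p ∈ N := by
    refine hN.sup_mem _ ?_ (Set.range_nonempty _) (hmono.directed_le.directedOn_range) p hp
    rintro _ ⟨n, rfl⟩
    exact hmem n
  have hq : ∀ x, Tendsto (fun n : ℕ => ((1 - y) ^ n) x) atTop (𝓝 ((1 - p) x)) := fun x => by
    have := (tendsto_const_nhds (x := x)).sub (hlim x)
    simpa using this
  -- An extra factor 1 - y only shifts the sequence of powers, so it fixes the range of the strong
  -- limit 1 - p. Then all powers fix that range, and the limit is idempotent.
  have hfix : ∀ x, (1 - y) ((1 - p) x) = (1 - p) x := fun x => by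
    have h1 := ((1 - y).continuous.tendsto _).comp (hq x)
    have h2 := (tendsto_add_atTop_iff_nat 1).2 (hq x)
    refine tendsto_nhds_unique h1 (h2.congr fun n => ?_)
    rw [pow_succ']
    rfl
  have hfixn : ∀ (n : ℕ) x, ((1 - y) ^ n) ((1 - p) x) = (1 - p) x := fun n x => by
    induction n with
    | zero => simp
    | succ n ih =>
      rw [pow_succ]
      exact (congrArg _ (hfix x)).trans ih
  have hidem : (1 - p) * (1 - p) = 1 - p := by
    ext x
    refine tendsto_nhds_unique (hq ((1 - p) x)) ?_
    simp only [hfixn]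
    exact tendsto_const_nhds
  have hproj : IsStarProjection (1 - p) :=
    ⟨hidem, (IsSelfAdjoint.one _).sub (hN.isSelfAdjoint p hpN)⟩
  refine ⟨p, by simpa using hproj.one_sub, hpN, ?_, hmono, fun n => ⟨hmem n, hle n⟩, hp⟩
  simpa using hp.1 ⟨1, rfl⟩

/-- F is directed, because the range projection of (y + z)/2 lies in F and dominates both y and z.
Its supremum then lies in F and is dominated by its own range projection. The lemma is applied to
the effects vanishing at a vector, the effects below a projection, and the effects killed by a
normal positive map. -/
theorem exists_isGreatest_projection {F : Set (H →L[ℂ] H)} (hF : F ⊆ effectsIn N)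
    (hne : F.Nonempty)
    (hle : ∀ y ∈ F, ∀ a ∈ effectsIn N, ∀ n : ℕ, a ≤ (n : ℝ) • y → a ∈ F)
    (hmid : ∀ y ∈ F, ∀ z ∈ F, (1 / 2 : ℝ) • (y + z) ∈ F)
    (hsup : ∀ D ⊆ F, D.Nonempty → DirectedOn (· ≤ ·) D → ∀ s, IsLUB D s → s ∈ F) :
    ∃ p, IsStarProjection p ∧ IsGreatest F p := by
  have key : ∀ y ∈ F, ∃ p ∈ F, IsStarProjection p ∧ y ≤ p := by
    intro y hy
    obtain ⟨p, hp, -, hyp, hmono, hn, hlub⟩ := hN.exists_projection_isLUB (hF hy)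
    refine ⟨p, ?_, hp, hyp⟩
    refine hsup _ ?_ (Set.range_nonempty _) (hmono.directed_le.directedOn_range) p hlub
    rintro _ ⟨n, rfl⟩
    exact hle y hy _ (hn n).1 n (hn n).2
  have hdir : DirectedOn (· ≤ ·) F := by
    intro y hy z hz
    obtain ⟨p, hpF, hp, hyp⟩ := key _ (hmid y hy z hz)
    have hsum : y + z ≤ (2 : ℝ) • p := by
      have := smul_le_smul_of_nonneg_left hyp (zero_le_two (α := ℝ))
      rw [smul_smul] at this
      norm_num at this
      exact this
    have h1 := le_add_of_nonneg_right (a := y) (hF hz).2.1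
    have h2 := le_add_of_nonneg_left (a := z) (hF hy).2.1
    exact ⟨p, hpF, le_of_le_smul (hF hy).2.1 (hF hy).2.2 hp (h1.trans hsum),
      le_of_le_smul (hF hz).2.1 (hF hz).2.2 hp (h2.trans hsum)⟩
  obtain ⟨t, ht, -⟩ := exists_isLUB_tendsto hne hdir fun d hd => (hF hd).2
  have htF := hsup F subset_rfl hne hdir t ht
  obtain ⟨p, hpF, hp, htp⟩ := key t htF
  exact ⟨p, hp, hpF, fun a ha => (ht.1 ha).trans htp⟩

end IsMonotoneClosedJordan

end MonotoneClosed

/-! ### The weak operator closure of a Jordan algebra -/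

section WOTClosure

variable {H : Type*} [NormedAddCommGroup H] [InnerProductSpace ℂ H] [CompleteSpace H]

namespace ContinuousLinearMapWOT

theorem continuous_left_mul (a : H →L[ℂ] H) :
    Continuous fun x : H →WOT[ℂ] H => ofCLM (a * x.toCLM) := by
  rw [continuous_iff]
  intro ξ η
  have h := continuous_inner_apply (𝕜 := ℂ) (E := H) (F := H) continuous_id ξ
    (ContinuousLinearMap.adjoint a η)
  simpa [ContinuousLinearMap.adjoint_inner_left] using h

theorem continuous_right_mul (a : H →L[ℂ] H) :
    Continuous fun x : H →WOT[ℂ] H => ofCLM (x.toCLM * a) := by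
  rw [continuous_iff]
  intro ξ η
  exact continuous_inner_apply (𝕜 := ℂ) (E := H) (F := H) continuous_id (a ξ) η

theorem tendsto_ofCLM_of_tendsto_apply {ι : Type*} {l : Filter ι} {f : ι → H →L[ℂ] H}
    {s : H →L[ℂ] H} (h : ∀ x, Tendsto (fun i => f i x) l (𝓝 (s x))) :
    Tendsto (fun i => ofCLM (f i)) l (𝓝 (ofCLM s)) :=
  tendsto_iff_forall_inner_apply_tendsto.2 fun x _ => tendsto_const_nhds.inner (h x)

end ContinuousLinearMapWOT

open ContinuousLinearMapWOT

/-- The unit of a JW-algebra is a two-sided unit for the operator product. -/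
theorem JWAlgebra.unit_mul (J : JWAlgebra H) {a : H →L[ℂ] H} (ha : a ∈ J.toSubmodule) :
    J.unit * a = a := by
  have h := J.unit_jordan' a ha
  have hu := J.unit_mul_self
  have h2 : J.unit * a + a * J.unit = (2 : ℝ) • a := by
    conv_rhs => rw [← h]
    rw [smul_smul]
    norm_num
  have h3 : J.unit * a * J.unit = J.unit * a := by
    have := congrArg (J.unit * ·) h2
    simp only [mul_add, ← mul_assoc, hu, two_smul] at this
    exact add_left_cancel this
  have h4 : J.unit * a * J.unit = a * J.unit := by
    have := congrArg (· * J.unit) h2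
    simp only [add_mul, mul_assoc, hu, two_smul] at this
    rw [← mul_assoc] at this
    exact add_right_cancel this
  rw [← h4, h3, ← two_smul ℝ] at h2
  exact smul_right_injective _ (two_ne_zero (α := ℝ)) h2

theorem JWAlgebra.isMonotoneClosedJordan (J : JWAlgebra H) :
    IsMonotoneClosedJordan J.toSubmodule J.unit where
  isSelfAdjoint := J.isSelfAdjoint'
  sq_mem a ha := by
    have h := J.jordan_mem' a ha a ha
    rwa [← two_smul ℝ, smul_smul, show (1 / 2 : ℝ) * 2 = 1 by norm_num, one_smul] at h
  isClosed := J.isClosed_wot'.preimage continuous_ofCLM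
  unit_mem := J.unit_mem'
  unit_mul a ha := J.unit_mul ha
  sup_mem D hD hne hdir s hs := by
    have := hdir.isDirectedOrder_coe
    have := hne.to_subtype
    exact IsClosed.mem_of_tendsto (s := {x : H →WOT[ℂ] H | x.toCLM ∈ J.carrier})
      (b := (atTop : Filter D)) J.isClosed_wot'
      (tendsto_ofCLM_of_tendsto_apply
        (tendsto_apply_of_isLUB hne hdir (fun d hd => (hD hd).2) hs))
      (Eventually.of_forall fun d => (hD d.2).1)

namespace IsMonotoneClosedJordan

variable {N : Submodule ℝ (H →L[ℂ] H)} {u : H →L[ℂ] H} (hN : IsMonotoneClosedJordan N u)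

/-- A weak operator closed space of operators closed under the norm closed Jordan structure is a
JW-algebra. -/
def toJWAlgebra (hcl : IsClosed {x : H →WOT[ℂ] H | x.toCLM ∈ N}) : JWAlgebra H where
  toSubmodule := N
  isSelfAdjoint' := hN.isSelfAdjoint
  jordan_mem' _ ha _ hb := N.smul_mem _ (hN.mul_add_mul_mem ha hb)
  isClosed_wot' := hcl
  unit := u
  unit_mem' := hN.unit_mem
  unit_jordan' a ha := by
    rw [hN.unit_mul a ha, hN.mul_unit ha, ← two_smul ℝ, smul_smul]
    norm_num

/-- The closure of `N` in the weak operator topology, a JW-algebra. -/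
def wotClosure : JWAlgebra H where
  carrier := {x | ofCLM x ∈ closure {y : H →WOT[ℂ] H | y.toCLM ∈ N}}
  add_mem' {a b} ha hb :=
    map_mem_closure₂ continuous_add ha hb fun _ h _ h' => N.add_mem h h'
  zero_mem' := subset_closure N.zero_mem
  smul_mem' c _ ha := map_mem_closure (f := fun x : H →WOT[ℂ] H => c • x)
    (continuous_const_smul c) ha fun _ h => N.smul_mem c h
  isSelfAdjoint' a ha := by
    have h : IsClosed {x : H →WOT[ℂ] H | star x = x} := isClosed_eq continuous_star continuous_id
    have h2 := closure_minimal (s := {y : H →WOT[ℂ] H | y.toCLM ∈ N})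
      (fun x (hx : x.toCLM ∈ N) => (congrArg ofCLM (hN.isSelfAdjoint _ hx) : star x = x)) h ha
    exact congrArg toCLM h2
  jordan_mem' a ha b hb := by
    have hcont : ∀ c : H →L[ℂ] H, Continuous fun x : H →WOT[ℂ] H =>
        ofCLM ((1 / 2 : ℝ) • (c * x.toCLM + x.toCLM * c)) := fun c =>
      ((continuous_left_mul c).add (continuous_right_mul c)).const_smul (1 / 2 : ℝ)
    -- The argument uses only separate continuity of the product, so one factor is moved to the
    -- closure at a time.
    have h1 : ∀ c ∈ N, ∀ x : H →L[ℂ] H, ofCLM x ∈ closure {y : H →WOT[ℂ] H | y.toCLM ∈ N} →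
        ofCLM ((1 / 2 : ℝ) • (c * x + x * c)) ∈ closure {y : H →WOT[ℂ] H | y.toCLM ∈ N} :=
      fun c hc x hx => map_mem_closure (f := fun x : H →WOT[ℂ] H =>
          ofCLM ((1 / 2 : ℝ) • (c * x.toCLM + x.toCLM * c))) (hcont c) hx fun y hy =>
        N.smul_mem _ (hN.mul_add_mul_mem hc hy)
    have h2 : ofCLM ((1 / 2 : ℝ) • (b * a + a * b)) ∈
        closure (closure {y : H →WOT[ℂ] H | y.toCLM ∈ N}) :=
      map_mem_closure (f := fun x : H →WOT[ℂ] H =>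
          ofCLM ((1 / 2 : ℝ) • (b * x.toCLM + x.toCLM * b))) (hcont b) ha fun y hy => by
        have := h1 y.toCLM hy b hb
        rwa [add_comm] at this
    rw [closure_closure, add_comm] at h2
    exact h2
  isClosed_wot' := isClosed_closure
  unit := u
  unit_mem' := subset_closure hN.unit_mem
  unit_jordan' a ha := by
    have hcont : Continuous fun x : H →WOT[ℂ] H =>
        ofCLM ((1 / 2 : ℝ) • (u * x.toCLM + x.toCLM * u)) :=
      ((continuous_left_mul u).add (continuous_right_mul u)).const_smul (1 / 2 : ℝ)
    have h2 := closure_minimal (s := {y : H →WOT[ℂ] H | y.toCLM ∈ N})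
      (fun x (hx : x.toCLM ∈ N) => show ofCLM _ = x from by
        rw [hN.unit_mul _ hx, hN.mul_unit hx, ← two_smul ℝ, smul_smul]
        norm_num) (isClosed_eq hcont continuous_id) ha
    exact congrArg toCLM h2

theorem subset_wotClosure : N ≤ (hN.wotClosure).toSubmodule := fun _ ha =>
  subset_closure (s := {y : H →WOT[ℂ] H | y.toCLM ∈ N}) ha

/-- Convexity upgrades weak to strong approximation: a functional on H × H separating (x ξ, x η)
from the pairs (c ξ, c η) would be weak operator continuous in the operator. -/
theorem exists_approx {x : H →L[ℂ] H} (hx : x ∈ (hN.wotClosure).toSubmodule) (ξ η : H) {δ : ℝ}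
    (hδ : 0 < δ) : ∃ c ∈ N, ‖c ξ - x ξ‖ < δ ∧ ‖c η - x η‖ < δ := by
  let Φ : (H →L[ℂ] H) →ₗ[ℝ] H × H :=
    { toFun := fun c => (c ξ, c η)
      map_add' := fun _ _ => rfl
      map_smul' := fun _ _ => rfl }
  have hmem : Φ x ∈ closure ((N.map Φ : Submodule ℝ (H × H)) : Set (H × H)) := by
    by_contra hcon
    obtain ⟨f, r, hf, hfx⟩ := RCLike.geometric_hahn_banach_closed_point (𝕜 := ℂ)
      (N.map Φ).convex.closure isClosed_closure hcon
    have hcont : Continuous fun y : H →WOT[ℂ] H => RCLike.re (f (y ξ, y η)) := by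
      have h1 := continuous_dual_apply (σ := RingHom.id ℂ) (E := H) (F := H) ξ
        (f.comp (ContinuousLinearMap.inl ℂ H H))
      have h2 := continuous_dual_apply (σ := RingHom.id ℂ) (E := H) (F := H) η
        (f.comp (ContinuousLinearMap.inr ℂ H H))
      refine RCLike.continuous_re.comp ((h1.add h2).congr fun y => ?_)
      simp [← map_add]
    have h3 := closure_minimal (s := {y : H →WOT[ℂ] H | y.toCLM ∈ N})
      (t := {y | RCLike.re (f (y ξ, y η)) ≤ r})
      (fun y hy => (hf _ (subset_closure ⟨y.toCLM, hy, rfl⟩)).le)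
      (isClosed_le hcont continuous_const) hx
    exact absurd hfx (not_lt.2 h3)
  obtain ⟨_, ⟨c, hc, rfl⟩, hd⟩ := Metric.mem_closure_iff.1 hmem δ hδ
  rw [dist_comm, Prod.dist_eq, max_lt_iff, dist_eq_norm, dist_eq_norm] at hd
  exact ⟨c, hc, hd.1, hd.2⟩

end IsMonotoneClosedJordan

end WOTClosure

/-! ### Functional calculus in N and approximation of projections from within N -/

section WOTClosed

variable {H : Type*} [NormedAddCommGroup H] [InnerProductSpace ℂ H] [CompleteSpace H]

namespace ContinuousLinearMap

theorem one_add_mul_mul_self_pos {w : ℝ} (hw : 0 < w) (t : ℝ) : 0 < 1 + w * (t * t) := by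
  have := mul_nonneg hw.le (mul_self_nonneg t)
  linarith

theorem cfcn_smul_mul_self {c : H →L[ℂ] H} (hc : IsSelfAdjoint c) {w : ℝ} (hw : 0 < w) :
    cfcₙ (fun x : ℝ => 1 - (1 + x)⁻¹) (w • (c * c)) =
      cfc (fun t : ℝ => 1 - (1 + w * (t * t))⁻¹) c := by
  have h1 : w • (c * c) = cfc (fun t : ℝ => w * (t * t)) c := by
    rw [cfc_const_mul w (fun t : ℝ => t * t) c, cfc_mul (fun t : ℝ => t) (fun t : ℝ => t) c,
      cfc_id' ℝ c]
  have hpos := one_add_mul_mul_self_pos hw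
  have hcont : ContinuousOn (fun x : ℝ => 1 - (1 + x)⁻¹)
      ((fun t : ℝ => w * (t * t)) '' spectrum ℝ c) := by
    refine continuousOn_const.sub (ContinuousOn.inv₀ (by fun_prop) ?_)
    rintro _ ⟨t, -, rfl⟩
    exact (hpos t).ne'
  have hspec : spectrum ℝ (cfc (fun t : ℝ => w * (t * t)) c) =
      (fun t : ℝ => w * (t * t)) '' spectrum ℝ c :=
    cfc_map_spectrum (R := ℝ) (fun t : ℝ => w * (t * t)) c (ha := hc)
      (hf := Continuous.continuousOn (by fun_prop))
  have hcont' : ContinuousOn (fun x : ℝ => 1 - (1 + x)⁻¹)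
      (quasispectrum ℝ (cfc (fun t : ℝ => w * (t * t)) c)) := by
    rw [quasispectrum_eq_spectrum_union_zero, hspec]
    refine continuousOn_const.sub (ContinuousOn.inv₀ (by fun_prop) ?_)
    rintro _ (⟨t, -, rfl⟩ | rfl)
    · exact (hpos t).ne'
    · norm_num
  rw [h1, cfcₙ_eq_cfc hcont' (by simp)]
  exact (cfc_comp' (fun x : ℝ => 1 - (1 + x)⁻¹) (fun t : ℝ => w * (t * t)) c hcont
    (Continuous.continuousOn (by fun_prop)) hc).symm

theorem cfc_two_mul_one_sub_sq_add {c : H →L[ℂ] H} (hc : IsSelfAdjoint c) (r : ℝ) :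
    cfc (fun t : ℝ => 2 * ((1 - t) * (1 - t)) + r) c =
      (2 : ℝ) • ((1 - c) * (1 - c)) + r • (1 : H →L[ℂ] H) := by
  have h1 : cfc (fun t : ℝ => 1 - t) c = 1 - c := by
    rw [cfc_sub (fun _ : ℝ => 1) (fun t : ℝ => t) c, cfc_id' ℝ c, cfc_const_one ℝ c]
  rw [cfc_add (R := ℝ) c (fun t : ℝ => 2 * ((1 - t) * (1 - t))) (fun _ => r)
      (Continuous.continuousOn (by fun_prop)) continuousOn_const,
    cfc_const_mul 2 (fun t : ℝ => (1 - t) * (1 - t)) c (Continuous.continuousOn (by fun_prop)),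
    cfc_mul (fun t : ℝ => 1 - t) (fun t : ℝ => 1 - t) c (Continuous.continuousOn (by fun_prop))
      (Continuous.continuousOn (by fun_prop)), h1, cfc_const r c hc,
    Algebra.algebraMap_eq_smul_one]

/-- By functional calculus this is the scalar estimate (1 + w t²)⁻¹ ≤ 2 (1 - t)² + 16/w. For t < 1/4
the square term already exceeds 1; for t ≥ 1/4 one has w t² ≥ w/16. -/
theorem one_sub_cfcn_le {c : H →L[ℂ] H} (hc : IsSelfAdjoint c) {w : ℝ} (hw : 0 < w) :
    1 - cfcₙ (fun x : ℝ => 1 - (1 + x)⁻¹) (w • (c * c)) ≤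
      (2 : ℝ) • ((1 - c) * (1 - c)) + (16 / w) • 1 := by
  have hpos := one_add_mul_mul_self_pos hw
  have hcont2 : Continuous (fun t : ℝ => 1 - (1 + w * (t * t))⁻¹) :=
    continuous_const.sub (Continuous.inv₀ (by fun_prop) fun t => (hpos t).ne')
  rw [cfcn_smul_mul_self hc hw, ← cfc_two_mul_one_sub_sq_add hc, ← cfc_const_one ℝ c hc,
    ← cfc_sub (fun _ : ℝ => 1) _ c continuousOn_const hcont2.continuousOn]
  refine cfc_mono (fun t _ => ?_) (continuous_const.sub hcont2).continuousOn
    (Continuous.continuousOn (by fun_prop))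
  rw [sub_sub_cancel]
  rcases lt_or_ge t (1 / 4) with ht | ht
  · have h1 : (1 + w * (t * t))⁻¹ ≤ 1 :=
      inv_le_one_of_one_le₀ (by linarith [mul_nonneg hw.le (mul_self_nonneg t)])
    have : 0 < 16 / w := by positivity
    nlinarith
  · have h5 : w / 16 ≤ 1 + w * (t * t) := by
      have : 1 / 16 ≤ t * t := by nlinarith
      nlinarith [mul_le_mul_of_nonneg_left this hw.le]
    have h6 := inv_anti₀ (by positivity) h5
    rw [inv_div] at h6
    nlinarith [mul_self_nonneg (1 - t)]

theorem cfcn_one_sub_inv_bounds {a : H →L[ℂ] H} (ha : 0 ≤ a) :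
    0 ≤ cfcₙ (fun x : ℝ => 1 - (1 + x)⁻¹) a ∧ cfcₙ (fun x : ℝ => 1 - (1 + x)⁻¹) a ≤ 1 ∧
      cfcₙ (fun x : ℝ => 1 - (1 + x)⁻¹) a ≤ a := by
  have hs : ∀ t ∈ quasispectrum ℝ a, 0 ≤ t := fun t ht => quasispectrum_nonneg_of_nonneg a ha t ht
  have hcont : ContinuousOn (fun x : ℝ => 1 - (1 + x)⁻¹) (quasispectrum ℝ a) := by
    refine continuousOn_const.sub (ContinuousOn.inv₀ (by fun_prop) fun t ht => ?_)
    have := hs t ht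
    positivity
  refine ⟨cfcₙ_nonneg fun t ht => ?_, ?_, ?_⟩
  · have := hs t ht
    exact sub_nonneg.2 (inv_le_one_of_one_le₀ (by linarith))
  · rw [cfcₙ_eq_cfc hcont (by simp)]
    refine cfc_le_one _ _ fun t ht => ?_
    have := hs t (spectrum_subset_quasispectrum ℝ a ht)
    exact sub_le_self _ (by positivity)
  · conv_rhs => rw [← cfcₙ_id' ℝ a]
    refine cfcₙ_mono (fun t ht => ?_) hcont continuousOn_id (by simp) rfl
    have := hs t ht
    have hp : 0 < 1 + t := by positivity
    have : 1 - (1 + t)⁻¹ = t / (1 + t) := by field_simp; ring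
    rw [this]
    exact div_le_self (hs t ht) (by linarith)

end ContinuousLinearMap

namespace IsMonotoneClosedJordan

variable {N : Submodule ℝ (H →L[ℂ] H)} {u : H →L[ℂ] H} (hN : IsMonotoneClosedJordan N u)
include hN

theorem pow_succ_mem {a : H →L[ℂ] H} (ha : a ∈ N) (n : ℕ) : a ^ (n + 1) ∈ N := by
  induction n with
  | zero => simpa using ha
  | succ n ih =>
    rw [pow_succ]
    exact hN.mul_mem_of_commute ih ha ((Commute.refl a).pow_left _)

theorem aeval_mem {a : H →L[ℂ] H} (ha : a ∈ N) {q : Polynomial ℝ} (hq : q.coeff 0 = 0) :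
    Polynomial.aeval a q ∈ N := by
  rw [Polynomial.aeval_eq_sum_range]
  refine N.sum_mem fun i _ => ?_
  cases i with
  | zero => simp [hq]
  | succ n => exact N.smul_mem _ (hN.pow_succ_mem ha n)

/-- The non-unital calculus is the right one, since N need not contain the identity operator: its
values are norm limits of polynomials in a without constant term. -/
theorem cfcn_mem {a : H →L[ℂ] H} (ha : a ∈ N) (f : ℝ → ℝ) : cfcₙ f a ∈ N := by
  refine closure_minimal ?_ hN.isClosed (cfcₙ_mem_elemental f a)
  intro x hx
  suffices ∃ q : Polynomial ℝ, q.coeff 0 = 0 ∧ Polynomial.aeval a q = x by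
    obtain ⟨q, hq, rfl⟩ := this
    exact hN.aeval_mem ha hq
  refine NonUnitalStarAlgebra.adjoin_induction (R := ℝ) (s := {a})
    (p := fun x _ => ∃ q : Polynomial ℝ, q.coeff 0 = 0 ∧ Polynomial.aeval a q = x)
    ?_ ?_ ?_ ?_ ?_ ?_ hx
  · rintro _ rfl
    exact ⟨Polynomial.X, by simp, by simp⟩
  · rintro _ _ - - ⟨q, hq, rfl⟩ ⟨r, hr, rfl⟩
    exact ⟨q + r, by simp [hq, hr], by simp⟩
  · exact ⟨0, by simp, by simp⟩
  · rintro _ _ - - ⟨q, hq, rfl⟩ ⟨r, hr, rfl⟩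
    exact ⟨q * r, by simp [Polynomial.mul_coeff_zero, hq], by simp⟩
  · rintro c _ - ⟨q, hq, rfl⟩
    exact ⟨c • q, by simp [hq], by simp⟩
  · rintro _ - ⟨q, hq, rfl⟩
    exact ⟨q, hq, (hN.isSelfAdjoint _ (hN.aeval_mem ha hq)).star_eq.symm⟩

theorem affine_mem_effectsIn {a : H →L[ℂ] H} (ha : a ∈ N) {r : ℝ} (hr : 0 < r) (har : ‖a‖ ≤ r) :
    (2 * r)⁻¹ • (a + r • u) ∈ effectsIn N := by
  have hu := hN.unit_mem_effectsIn
  have h1 : a ≤ r • u :=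
    (hN.le_norm_smul_unit ha).trans (smul_le_smul_of_nonneg_right har hu.2.1)
  have h2 : -a ≤ r • u := by
    refine (hN.le_norm_smul_unit (N.neg_mem ha)).trans (smul_le_smul_of_nonneg_right ?_ hu.2.1)
    rwa [norm_neg]
  refine ⟨N.smul_mem _ (N.add_mem ha (N.smul_mem _ hu.1)), ?_, ?_⟩
  · exact smul_nonneg (by positivity) (by rwa [add_comm, ← neg_le_iff_add_nonneg])
  · refine le_trans ?_ hu.2.2
    calc (2 * r)⁻¹ • (a + r • u) ≤ (2 * r)⁻¹ • (r • u + r • u) :=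
          smul_le_smul_of_nonneg_left (by gcongr) (by positivity)
      _ = u := by
          rw [← two_smul ℝ, smul_smul, smul_smul, mul_assoc, inv_mul_cancel₀ (by positivity),
            one_smul]

/-- Take c k in N close to p at ξ and η, let S m be the partial sums of (k + 1) (c k)², and let b be
the supremum of S m (1 + S m)⁻¹, increasing because x ↦ 1 - (1 + x)⁻¹ is operator monotone. The
growing weights force b ξ = ξ, while b is small at η because all the S m are. -/
theorem exists_effect_fixing {p : H →L[ℂ] H} (hp : p ∈ hN.wotClosure.toSubmodule) {ξ η : H}
    (hξ : p ξ = ξ) (hη : p η = 0) {ε : ℝ} (hε : 0 < ε) :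
    ∃ b ∈ effectsIn N, b ξ = ξ ∧ b.reApplyInnerSelf η ≤ ε := by
  -- The bounds at η are terms of a geometric series with sum ε, after multiplication by the weight
  -- k + 1.
  have hc : ∀ k : ℕ, ∃ c ∈ N, ‖c ξ - ξ‖ ≤ ((k : ℝ) + 1)⁻¹ ∧
      ((k : ℝ) + 1) * ‖c η‖ ^ 2 ≤ ε / 2 / 2 ^ k := by
    intro k
    have hk : (0 : ℝ) < (k : ℝ) + 1 := by positivity
    obtain ⟨c, hcN, h1, h2⟩ := hN.exists_approx hp ξ η
      (δ := min ((k : ℝ) + 1)⁻¹ (√(ε / 2 / 2 ^ k / ((k : ℝ) + 1)))) (by positivity)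
    rw [hξ] at h1
    rw [hη, sub_zero] at h2
    refine ⟨c, hcN, (h1.trans_le (min_le_left _ _)).le, ?_⟩
    have h3 := (h2.trans_le (min_le_right _ _)).le
    rw [Real.le_sqrt (norm_nonneg _) (by positivity), le_div_iff₀ hk] at h3
    linarith
  choose c hcN hcξ hcη using hc
  have hsa := fun k => hN.isSelfAdjoint _ (hcN k)
  have hsq : ∀ k : ℕ, 0 ≤ ((k : ℝ) + 1) • (c k * c k) := fun k => by
    refine smul_nonneg (by positivity) ?_
    have := star_mul_self_nonneg (c k)
    rwa [(hsa k).star_eq] at this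
  set S : ℕ → H →L[ℂ] H := fun m => ∑ k ∈ Finset.range m, ((k : ℝ) + 1) • (c k * c k) with hS
  have hSmono : Monotone S := monotone_nat_of_le_succ fun m => by
    simp only [hS, Finset.sum_range_succ]
    exact le_add_of_nonneg_right (hsq m)
  have hS0 : ∀ m, 0 ≤ S m := fun m => Finset.sum_nonneg fun k _ => hsq k
  have hSN : ∀ m, S m ∈ N := fun m => N.sum_mem fun k _ => N.smul_mem _ (hN.sq_mem _ (hcN k))
  have hbnd := fun m => cfcn_one_sub_inv_bounds (hS0 m)
  have hbmono : Monotone fun m => cfcₙ (fun x : ℝ => 1 - (1 + x)⁻¹) (S m) := fun m n hmn =>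
    CFC.monotoneOn_one_sub_one_add_inv_real (hS0 m) (hS0 n) (hSmono hmn)
  obtain ⟨b, hb, hlim⟩ := exists_isLUB_range_tendsto hbmono (fun m => (hbnd m).1)
    (fun m => (hbnd m).2.1)
  have hb0 : 0 ≤ b := (hbnd 0).1.trans (hb.1 ⟨0, rfl⟩)
  have hb1 : b ≤ 1 := hb.2 (by rintro _ ⟨m, rfl⟩; exact (hbnd m).2.1)
  have hbN : b ∈ N := by
    refine hN.sup_mem _ ?_ (Set.range_nonempty _) (hbmono.directed_le.directedOn_range) b hb
    rintro _ ⟨m, rfl⟩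
    exact ⟨hN.cfcn_mem (hSN m) _, (hbnd m).1, (hbnd m).2.1⟩
  refine ⟨b, ⟨hbN, hb0, hb1⟩, ?_, ?_⟩
  · have h1 : ∀ m : ℕ, (1 - b).reApplyInnerSelf ξ ≤
        2 * (((m : ℝ) + 1)⁻¹) ^ 2 + 16 * ((m : ℝ) + 1)⁻¹ * ‖ξ‖ ^ 2 := by
      intro m
      have hm : (0 : ℝ) < (m : ℝ) + 1 := by positivity
      have h2 : ((m : ℝ) + 1) • (c m * c m) ≤ S (m + 1) := by
        simp only [hS, Finset.sum_range_succ]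
        exact le_add_of_nonneg_left (hS0 m)
      have h3 := CFC.monotoneOn_one_sub_one_add_inv_real (hsq m) (hS0 (m + 1)) h2
      have h4 : 1 - b ≤ 1 - cfcₙ (fun x : ℝ => 1 - (1 + x)⁻¹) (((m : ℝ) + 1) • (c m * c m)) :=
        sub_le_sub_left (h3.trans (hb.1 ⟨m + 1, rfl⟩)) _
      refine (reApplyInnerSelf_mono (h4.trans (one_sub_cfcn_le (hsa m) hm)) ξ).trans ?_
      have h5 := reApplyInnerSelf_mul_self ((IsSelfAdjoint.one _).sub (hsa m)) ξ
      have h6 : ((2 : ℝ) • ((1 - c m) * (1 - c m)) + (16 / ((m : ℝ) + 1)) • (1 : H →L[ℂ] H)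
          ).reApplyInnerSelf ξ = 2 * ((1 - c m) * (1 - c m)).reApplyInnerSelf ξ +
            16 / ((m : ℝ) + 1) * ‖ξ‖ ^ 2 := by
        simp only [reApplyInnerSelf_apply, add_apply, smul_apply, inner_add_left, map_add,
          inner_smul_left_eq_smul, one_apply_eq_self, RCLike.smul_re]
        rw [inner_self_eq_norm_sq]
      rw [h6, h5, sub_apply, one_apply_eq_self, norm_sub_rev, div_eq_mul_inv]
      have := hcξ m
      gcongr
    have h2 : Tendsto (fun m : ℕ => ((m : ℝ) + 1)⁻¹) atTop (𝓝 0) := by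
      simpa [one_div] using tendsto_one_div_add_atTop_nhds_zero_nat (𝕜 := ℝ)
    have h3 := ((h2.pow 2).const_mul 2).add ((h2.const_mul 16).mul_const (‖ξ‖ ^ 2))
    have h4 := ge_of_tendsto' h3 h1
    have h5 := norm_apply_sq_le (sub_nonneg.2 hb1) (sub_le_self _ hb0) ξ
    have h6 : ‖(1 - b) ξ‖ = 0 := by nlinarith [norm_nonneg ((1 - b) ξ)]
    rw [norm_eq_zero, sub_apply, one_apply_eq_self, sub_eq_zero] at h6
    exact h6.symm
  · refine le_of_tendsto' (tendsto_reApplyInnerSelf hlim η) fun m => ?_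
    refine (reApplyInnerSelf_mono (hbnd m).2.2 η).trans ?_
    have h1 : (S m).reApplyInnerSelf η =
        ∑ k ∈ Finset.range m, ((k : ℝ) + 1) * ‖c k η‖ ^ 2 := by
      simp only [hS, ← reApplyInnerSelf_mul_self (hsa _)]
      simp only [reApplyInnerSelf_apply, sum_apply, sum_inner, map_sum, smul_apply,
          inner_smul_left_eq_smul, RCLike.smul_re]
    rw [h1]
    exact (Finset.sum_le_sum fun k _ => hcη k).trans
      ((summable_geometric_two' ε).sum_le_tsum _ (fun k _ => by positivity)
        |>.trans_eq (tsum_geometric_two' ε))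

end IsMonotoneClosedJordan

end WOTClosed

/-! ### Monotone closed Jordan algebras are weak operator closed -/

section WOTClosedTheorem

variable {H : Type*} [NormedAddCommGroup H] [InnerProductSpace ℂ H] [CompleteSpace H]

theorem midpoint_mem_effectsIn {N : Submodule ℝ (H →L[ℂ] H)} {a b : H →L[ℂ] H}
    (ha : a ∈ effectsIn N) (hb : b ∈ effectsIn N) : (1 / 2 : ℝ) • (a + b) ∈ effectsIn N := by
  refine ⟨N.smul_mem _ (N.add_mem ha.1 hb.1), smul_nonneg (by norm_num) (add_nonneg ha.2.1 hb.2.1),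
    ?_⟩
  calc (1 / 2 : ℝ) • (a + b) ≤ (1 / 2 : ℝ) • ((1 : H →L[ℂ] H) + 1) :=
        smul_le_smul_of_nonneg_left (add_le_add ha.2.2 hb.2.2) (by norm_num)
    _ = 1 := by rw [← two_smul ℝ, smul_smul]; norm_num

namespace IsMonotoneClosedJordan

variable {N : Submodule ℝ (H →L[ℂ] H)} {u : H →L[ℂ] H} (hN : IsMonotoneClosedJordan N u)
include hN

theorem sup_mem_effectsIn {D : Set (H →L[ℂ] H)} (hD : D ⊆ effectsIn N) (hne : D.Nonempty)
    (hdir : DirectedOn (· ≤ ·) D) {s : H →L[ℂ] H} (hs : IsLUB D s) : s ∈ effectsIn N := by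
  refine ⟨hN.sup_mem D hD hne hdir s hs, ?_, hs.2 fun d hd => (hD hd).2.2⟩
  obtain ⟨d, hd⟩ := hne
  exact (hD hd).2.1.trans (hs.1 hd)

theorem zero_mem_effectsIn : 0 ∈ effectsIn N :=
  ⟨N.zero_mem, le_rfl, hN.unit_mem_effectsIn.2.1.trans hN.unit_mem_effectsIn.2.2⟩

theorem exists_isGreatest_vanishing (ξ : H) :
    ∃ s, IsStarProjection s ∧ IsGreatest {a ∈ effectsIn N | a ξ = 0} s := by
  refine hN.exists_isGreatest_projection (fun a ha => ha.1) ⟨0, hN.zero_mem_effectsIn, rfl⟩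
    ?_ ?_ ?_
  · intro y hy a ha n han
    exact ⟨ha, apply_eq_zero_of_le ha.2.1 ha.2.2 han (by simp [hy.2])⟩
  · intro y hy z hz
    exact ⟨midpoint_mem_effectsIn hy.1 hz.1, by simp [hy.2, hz.2]⟩
  · intro D hD hne hdir s hs
    refine ⟨hN.sup_mem_effectsIn (fun d hd => (hD hd).1) hne hdir hs, ?_⟩
    have := hdir.isDirectedOrder_coe
    have := hne.to_subtype
    have h := tendsto_apply_of_isLUB hne hdir (fun d hd => (hD hd).1.2) hs ξ
    refine tendsto_nhds_unique h (tendsto_const_nhds.congr fun d => ?_)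
    exact (hD d.2).2.symm

theorem exists_isGreatest_le_projection {p : H →L[ℂ] H} (hp : IsStarProjection p) :
    ∃ s, IsStarProjection s ∧ IsGreatest {a ∈ effectsIn N | a ≤ p} s := by
  refine hN.exists_isGreatest_projection (fun a ha => ha.1)
    ⟨0, hN.zero_mem_effectsIn, hp.nonneg⟩ ?_ ?_ ?_
  · intro y hy a ha n han
    exact ⟨ha, le_of_le_smul ha.2.1 ha.2.2 hp
      (han.trans (smul_le_smul_of_nonneg_left hy.2 (Nat.cast_nonneg n)))⟩
  · intro y hy z hz
    refine ⟨midpoint_mem_effectsIn hy.1 hz.1, ?_⟩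
    calc (1 / 2 : ℝ) • (y + z) ≤ (1 / 2 : ℝ) • (p + p) :=
          smul_le_smul_of_nonneg_left (add_le_add hy.2 hz.2) (by norm_num)
      _ = p := by rw [← two_smul ℝ, smul_smul]; norm_num
  · intro D hD hne hdir s hs
    exact ⟨hN.sup_mem_effectsIn (fun d hd => (hD hd).1) hne hdir hs, hs.2 fun d hd => (hD hd).2⟩

/-- Let q be the greatest effect of N below p. For ξ in the range of p, let s be the greatest effect
of N killing ξ. By `exists_effect_fixing`, u - s vanishes on the kernel of p, so u - s ≤ p and hence
u - s ≤ q. Then u - q ≤ s kills ξ, that is, q ξ = ξ, and q = p. -/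
theorem projection_mem_of_mem_wotClosure {p : H →L[ℂ] H} (hp : IsStarProjection p)
    (hpK : p ∈ hN.wotClosure.toSubmodule) : p ∈ N := by
  obtain ⟨q, -, hq⟩ := hN.exists_isGreatest_le_projection hp
  have hup : u * p = p := hN.wotClosure.unit_mul hpK
  have key : ∀ x, q (p x) = p x := by
    intro x
    have hξ : p (p x) = p x := congrArg (fun T : H →L[ℂ] H => T x) hp.isIdempotentElem
    have hu : u (p x) = p x := congrArg (fun T : H →L[ℂ] H => T x) hup
    obtain ⟨s, -, hs⟩ := hN.exists_isGreatest_vanishing (p x)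
    have hus := hN.unit_sub_mem hs.1.1
    have hker : ∀ η, p η = 0 → (u - s) η = 0 := by
      intro η hη
      have h1 : (u - s).reApplyInnerSelf η ≤ 0 := by
        refine le_of_forall_pos_le_add fun ε hε => ?_
        obtain ⟨b, hb, hbξ, hbη⟩ := hN.exists_effect_fixing hpK hξ hη hε
        have h2 : u - b ≤ s := hs.2 ⟨hN.unit_sub_mem hb, by simp [hu, hbξ]⟩
        have h3 := reApplyInnerSelf_mono (sub_le_comm.1 h2) η
        linarith
      have h2 := norm_apply_sq_le hus.2.1 hus.2.2 η
      have h3 : ‖(u - s) η‖ = 0 := by nlinarith [norm_nonneg ((u - s) η)]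
      exact norm_eq_zero.1 h3
    have h4 : (u - s) * p = u - s := by
      ext y
      have hy : p (p y) = p y := congrArg (fun T : H →L[ℂ] H => T y) hp.isIdempotentElem
      have := hker (y - p y) (by simp [hy])
      rw [map_sub, sub_eq_zero] at this
      exact this.symm
    have h5 : p * (u - s) = u - s := by
      have := congrArg star h4
      rwa [star_mul, hus.2.1.isSelfAdjoint.star_eq, hp.isSelfAdjoint.star_eq] at this
    have h6 : u - s ≤ p := by
      have := star_left_conjugate_le_conjugate hus.2.2 p
      rwa [hp.isSelfAdjoint.star_eq, h5, h4, mul_one, hp.isIdempotentElem.eq] at this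
    have h7 : u - q ≤ s := sub_le_comm.1 (hq.2 ⟨hus, h6⟩)
    have huq := hN.unit_sub_mem hq.1.1
    have h8 := apply_eq_zero_of_le huq.2.1 huq.2.2 h7 hs.1.2
    rw [sub_apply, hu, sub_eq_zero] at h8
    exact h8.symm
  have h1 : q * p = p := by
    ext x
    exact key x
  have h2 := mul_eq_self_of_le_smul (c := 1) hq.1.1.2.1 hq.1.1.2.2 hp (by simpa using hq.1.2)
  rw [← h1, h2.1]
  exact hq.1.1.1

/-- This extracts one binary digit of x. For p the range projection of f(x), f(t) = max(0, 2t - 1),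
one has 2x - 1 ≤ f(x) ≤ p, and p ≤ 2x because 1 - (1 - f(t))ⁿ ≤ 2t on [0, 1]. -/
theorem exists_projection_half {x : H →L[ℂ] H} (hx : x ∈ effectsIn N) :
    ∃ p ∈ N, IsStarProjection p ∧ (2 : ℝ) • x - p ∈ effectsIn N := by
  have hsa := hx.2.1.isSelfAdjoint
  set f : ℝ → ℝ := fun t => max 0 (2 * t - 1) with hf
  have hfc : Continuous f := by fun_prop
  have hz : cfcₙ f x = cfc f x := cfcₙ_eq_cfc hfc.continuousOn (by simp [hf])
  have hs0 : ∀ t ∈ spectrum ℝ x, 0 ≤ t := fun t ht => spectrum_nonneg_of_nonneg hx.2.1 ht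
  have hs1 : ∀ t ∈ spectrum ℝ x, t ≤ 1 := by
    have := (le_algebraMap_iff_spectrum_le (r := (1 : ℝ)) hsa).1 (by simpa using hx.2.2)
    exact this
  have hzmem : cfc f x ∈ effectsIn N := by
    refine ⟨hz ▸ hN.cfcn_mem hx.1 f, cfc_nonneg fun t _ => le_max_left _ _,
      cfc_le_one _ _ fun t ht => ?_⟩
    have := hs1 t ht
    exact max_le zero_le_one (by linarith)
  obtain ⟨p, hp, hpN, hzp, -, -, hlub⟩ := hN.exists_projection_isLUB hzmem
  have h2x : cfc (fun t : ℝ => 2 * t) x = (2 : ℝ) • x := by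
    rw [cfc_const_mul 2 (fun t : ℝ => t) x, cfc_id' ℝ x]
  refine ⟨p, hpN, hp, N.sub_mem (N.smul_mem _ hx.1) hpN, sub_nonneg.2 (hlub.2 ?_), ?_⟩
  · rintro _ ⟨n, rfl⟩
    have h1 : 1 - (1 - cfc f x) ^ n = cfc (fun t => 1 - (1 - f t) ^ n) x := by
      rw [cfc_sub (R := ℝ) (fun _ => 1) (fun t => (1 - f t) ^ n) x continuousOn_const
        (Continuous.continuousOn (by fun_prop)), cfc_pow (R := ℝ) (fun t => 1 - f t) n x
        (Continuous.continuousOn (by fun_prop)), cfc_sub (R := ℝ) (fun _ => 1) f x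
        continuousOn_const hfc.continuousOn, cfc_const_one ℝ x]
    change 1 - (1 - cfc f x) ^ n ≤ _
    rw [h1, ← h2x]
    refine cfc_mono (fun t ht => ?_) (Continuous.continuousOn (by fun_prop))
      (Continuous.continuousOn (by fun_prop))
    have h0 := hs0 t ht
    have h1 := hs1 t ht
    rcases le_total (2 * t - 1) 0 with h | h
    · simp [hf, max_eq_left h, h0]
    · have : 0 ≤ (1 - f t) ^ n := pow_nonneg (by simp only [hf, max_eq_right h]; linarith) n
      linarith
  · have h3 : (2 : ℝ) • x - 1 ≤ cfc f x := by
      rw [← h2x, ← cfc_const_one ℝ x, ← cfc_sub (R := ℝ) (fun t => 2 * t) (fun _ => 1) x]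
      exact cfc_mono fun t _ => le_max_right _ _
    exact sub_le_comm.1 (h3.trans hzp)

/-- A monotone closed Jordan algebra of self-adjoint operators is closed in the weak operator
topology. -/
theorem isClosed_wot : IsClosed {x : H →WOT[ℂ] H | x.toCLM ∈ N} := by
  refine isClosed_of_closure_subset fun x hx => ?_
  have hK := hN.wotClosure.isMonotoneClosedJordan
  have hNK := hN.subset_wotClosure
  have heff : ∀ x ∈ effectsIn hN.wotClosure.toSubmodule, x ∈ N := by
    intro x hx
    -- Binary expansion: the digits are projections of the closure, which already lie in N, and the
    -- remainder after n digits has norm at most 2⁻ⁿ.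
    have hdyadic : ∀ n : ℕ, ∃ y ∈ N, ∃ r ∈ effectsIn hN.wotClosure.toSubmodule,
        x = y + ((1 / 2 : ℝ) ^ n) • r := by
      intro n
      induction n with
      | zero => exact ⟨0, N.zero_mem, x, hx, by simp⟩
      | succ n ih =>
        obtain ⟨y, hy, r, hr, rfl⟩ := ih
        obtain ⟨p, hpK, hp, hr'⟩ := hK.exists_projection_half hr
        refine ⟨y + ((1 / 2 : ℝ) ^ (n + 1)) • p,
          N.add_mem hy (N.smul_mem _ (hN.projection_mem_of_mem_wotClosure hp hpK)), _, hr', ?_⟩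
        rw [pow_succ]
        module
    refine hN.isClosed.closure_subset (Metric.mem_closure_iff.2 fun ε hε => ?_)
    obtain ⟨n, hn⟩ := exists_pow_lt_of_lt_one hε (one_half_lt_one (α := ℝ))
    obtain ⟨y, hy, r, hr, hxy⟩ := hdyadic n
    refine ⟨y, hy, ?_⟩
    rw [dist_eq_norm, hxy, add_sub_cancel_left, norm_smul, norm_pow,
      Real.norm_of_nonneg (by norm_num)]
    have := (CStarAlgebra.norm_le_one_iff_of_nonneg r hr.2.1).2 hr.2.2
    nlinarith [pow_pos (one_half_pos (α := ℝ)) n]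
  have hxK : x.toCLM ∈ hN.wotClosure.toSubmodule := hx
  have hr : 0 < ‖x.toCLM‖ + 1 := by positivity
  have h1 := heff _ (hK.affine_mem_effectsIn hxK hr (by linarith))
  have h2 := N.sub_mem (N.smul_mem (2 * (‖x.toCLM‖ + 1)) h1)
    (N.smul_mem (‖x.toCLM‖ + 1) hN.unit_mem)
  rw [smul_smul, mul_inv_cancel₀ (by positivity), one_smul] at h2
  have h3 : hN.wotClosure.unit = u := rfl
  rw [h3, add_sub_cancel_right] at h2
  exact h2

end IsMonotoneClosedJordan

end WOTClosedTheorem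

/-! ### Positive unital maps and Kadison's inequality -/

section PositiveMaps

variable {H : Type*} [NormedAddCommGroup H] [InnerProductSpace ℂ H] [CompleteSpace H]

theorem ContinuousLinearMap.eq_zero_of_forall_nonneg_add_smul {A B : H →L[ℂ] H}
    (h : ∀ t : ℝ, 0 ≤ A + t • B) : B = 0 := by
  have hlim : ∀ C : H →L[ℂ] H, ∀ x,
      Tendsto (fun n : ℕ => ((((n : ℝ) + 1)⁻¹) • A + C) x) atTop (𝓝 (C x)) := by
    intro C x
    have h1 : Tendsto (fun n : ℕ => ((n : ℝ) + 1)⁻¹) atTop (𝓝 0) := by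
      simpa [one_div] using tendsto_one_div_add_atTop_nhds_zero_nat (𝕜 := ℝ)
    simpa using (h1.smul_const (A x)).add_const (C x)
  have hpos : ∀ C : H →L[ℂ] H, (∀ n : ℕ, 0 ≤ A + ((n : ℝ) + 1) • C) → 0 ≤ C := by
    intro C hC
    refine ge_of_tendsto_apply (l := atTop) (Eventually.of_forall fun n : ℕ => ?_) (hlim C)
    have hn : (0 : ℝ) < (n : ℝ) + 1 := by positivity
    have h2 := smul_nonneg (inv_nonneg.2 hn.le) (hC n)
    rwa [smul_add, smul_smul, inv_mul_cancel₀ hn.ne', one_smul] at h2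
  refine le_antisymm (neg_nonneg.1 (hpos _ fun n => ?_)) (hpos _ fun n => h _)
  have := h (-((n : ℝ) + 1))
  rwa [neg_smul, ← smul_neg] at this

theorem ContinuousLinearMap.nonneg_mul_self {a : H →L[ℂ] H} (ha : IsSelfAdjoint a) :
    0 ≤ a * a := by
  have := star_mul_self_nonneg a
  rwa [ha.star_eq] at this

/-- `T` restricts to a positive unital linear map on `N`. -/
structure IsPositiveUnitalOn (N : Submodule ℝ (H →L[ℂ] H)) (u : H →L[ℂ] H)
    (T : (H →L[ℂ] H) → H →L[ℂ] H) : Prop where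
  map_mem : ∀ a ∈ N, T a ∈ N
  map_add : ∀ a ∈ N, ∀ b ∈ N, T (a + b) = T a + T b
  map_smul : ∀ (c : ℝ), ∀ a ∈ N, T (c • a) = c • T a
  map_nonneg : ∀ a ∈ N, 0 ≤ a → 0 ≤ T a
  map_unit : T u = u

/-- `T` preserves suprema of upward directed sets of effects of `N`. -/
def IsNormalOn (N : Submodule ℝ (H →L[ℂ] H)) (T : (H →L[ℂ] H) → H →L[ℂ] H) : Prop :=
  ∀ D ⊆ effectsIn N, D.Nonempty → DirectedOn (· ≤ ·) D → ∀ s, IsLUB D s → IsLUB (T '' D) (T s)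

namespace IsPositiveUnitalOn

variable {N : Submodule ℝ (H →L[ℂ] H)} {u : H →L[ℂ] H} {T : (H →L[ℂ] H) → H →L[ℂ] H}
  (hT : IsPositiveUnitalOn N u T)
include hT

theorem map_zero : T 0 = 0 := by
  simpa using hT.map_smul 0 0 N.zero_mem

theorem map_neg {a : H →L[ℂ] H} (ha : a ∈ N) : T (-a) = -T a := by
  simpa using hT.map_smul (-1) a ha

theorem map_sub {a b : H →L[ℂ] H} (ha : a ∈ N) (hb : b ∈ N) : T (a - b) = T a - T b := by
  rw [sub_eq_add_neg, hT.map_add a ha _ (N.neg_mem hb), hT.map_neg hb, ← sub_eq_add_neg]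

theorem map_sum {ι : Type*} (s : Finset ι) (f : ι → H →L[ℂ] H) (hf : ∀ i ∈ s, f i ∈ N) :
    T (∑ i ∈ s, f i) = ∑ i ∈ s, T (f i) := by
  classical
  induction s using Finset.induction_on with
  | empty => simpa using hT.map_zero
  | insert i s his ih =>
    have hs := fun j hj => hf j (Finset.mem_insert_of_mem hj)
    rw [Finset.sum_insert his, Finset.sum_insert his,
      hT.map_add _ (hf i (Finset.mem_insert_self _ _)) _ (N.sum_mem hs), ih hs]

theorem mono {a b : H →L[ℂ] H} (ha : a ∈ N) (hb : b ∈ N) (hab : a ≤ b) : T a ≤ T b := by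
  rw [← sub_nonneg, ← hT.map_sub hb ha]
  exact hT.map_nonneg _ (N.sub_mem hb ha) (sub_nonneg.2 hab)

variable (hN : IsMonotoneClosedJordan N u)
include hN

theorem map_mem_effectsIn {a : H →L[ℂ] H} (ha : a ∈ effectsIn N) : T a ∈ effectsIn N := by
  refine ⟨hT.map_mem a ha.1, hT.map_nonneg a ha.1 ha.2.1, ?_⟩
  have := hT.mono ha.1 hN.unit_mem (hN.le_unit ha.1 ha.2.2)
  rw [hT.map_unit] at this
  exact this.trans hN.unit_mem_effectsIn.2.2

/-- Kadison's inequality for effects, by way of the Bernstein polynomials. -/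
theorem map_mul_self_le_of_effect {a : H →L[ℂ] H} (ha : a ∈ effectsIn N) :
    T a * T a ≤ T (a * a) := by
  have hz0 : 0 ≤ 1 - a := sub_nonneg.2 ha.2.2
  have hpow : ∀ b : H →L[ℂ] H, 0 ≤ b → ∀ n : ℕ, 0 ≤ b ^ n := fun b hb n => by
    induction n with
    | zero => simp
    | succ n ih =>
      rw [pow_succ]
      exact Commute.mul_nonneg ih hb ((Commute.refl _).pow_left n)
  have hcomm : Commute a (1 - a) := (Commute.one_right a).sub_right (Commute.refl a)
  have hTa := hT.map_mem_effectsIn hN ha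
  have hsa := hTa.2.1.isSelfAdjoint
  have hTaa := hT.map_nonneg _ (hN.sq_mem a ha.1) (nonneg_mul_self ha.2.1.isSelfAdjoint)
  have key : ∀ n : ℕ, T a * T a ≤ T (a * a) + ((n : ℝ) + 1)⁻¹ • T a := by
    intro m
    set n := m + 1 with hn
    -- The Bernstein operators act as a discrete positive spectral resolution of a, with e k sitting
    -- at the point k/n.
    set e : ℕ → H →L[ℂ] H := fun k => Polynomial.aeval a (bernsteinPolynomial ℝ n k) with he
    have he0 : ∀ k, 0 ≤ e k := fun k => by
      have : e k = (n.choose k : ℝ) • (a ^ k * (1 - a) ^ (n - k)) := by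
        simp [he, bernsteinPolynomial, mul_assoc, Nat.cast_smul_eq_nsmul]
      rw [this]
      exact smul_nonneg (Nat.cast_nonneg _) (Commute.mul_nonneg (hpow a ha.2.1 k)
        (hpow _ hz0 _) (hcomm.pow_pow _ _))
    -- The index 0 is left out: e 0 = (1 - a)ⁿ has constant term 1 and may fall outside N. It does
    -- not contribute to the first and second moments.
    have heN : ∀ k, e (k + 1) ∈ N := fun k => hN.aeval_mem ha.1 (by
      rw [Polynomial.coeff_zero_eq_eval_zero, bernsteinPolynomial.eval_at_0]
      simp)
    have hs0 : ∑ k ∈ Finset.range n, e (k + 1) + e 0 = 1 := by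
      rw [← Finset.sum_range_succ', he, ← _root_.map_sum, bernsteinPolynomial.sum, _root_.map_one]
    have hs1 : ∑ k ∈ Finset.range n, ((k : ℝ) + 1) • e (k + 1) = (n : ℝ) • a := by
      have h := congrArg (Polynomial.aeval a) (bernsteinPolynomial.sum_smul ℝ n)
      rw [_root_.map_sum, Finset.sum_range_succ'] at h
      simp only [zero_smul, _root_.map_zero, add_zero, map_nsmul, Polynomial.aeval_X] at h
      rw [Nat.cast_smul_eq_nsmul, ← h]
      refine Finset.sum_congr rfl fun k _ => ?_
      rw [← Nat.cast_smul_eq_nsmul ℝ, Nat.cast_succ]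
    have hs2 : ∑ k ∈ Finset.range n, (((k : ℝ) + 1) * k) • e (k + 1) =
        ((n : ℝ) * m) • (a * a) := by
      have h := congrArg (Polynomial.aeval a) (bernsteinPolynomial.sum_mul_smul ℝ n)
      rw [_root_.map_sum, Finset.sum_range_succ'] at h
      simp only [zero_mul, zero_smul, _root_.map_zero, add_zero, map_nsmul, Polynomial.aeval_X,
        _root_.map_pow, Nat.add_sub_cancel, hn] at h
      rw [← pow_two, ← Nat.cast_mul, Nat.cast_smul_eq_nsmul, ← h]
      refine Finset.sum_congr rfl fun k _ => ?_
      rw [← Nat.cast_smul_eq_nsmul ℝ, Nat.cast_mul, Nat.cast_succ]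
    set t : ℕ → H →L[ℂ] H := fun k => T (e (k + 1)) with ht
    have ht0 : ∀ k, 0 ≤ t k := fun k => hT.map_nonneg _ (heN k) (he0 _)
    have ht1 : ∑ k ∈ Finset.range n, t k ≤ 1 := by
      rw [ht, ← hT.map_sum _ _ fun k _ => heN k]
      refine (hT.map_mem_effectsIn hN ⟨N.sum_mem fun k _ => heN k,
        Finset.sum_nonneg fun k _ => he0 _, ?_⟩).2.2
      rw [← hs0]
      exact le_add_of_nonneg_right (he0 0)
    have ht2 : ∑ k ∈ Finset.range n, ((k : ℝ) + 1) • t k = (n : ℝ) • T a := by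
      rw [← hT.map_smul _ a ha.1, ← hs1, hT.map_sum _ _ fun k _ => N.smul_mem _ (heN k)]
      exact Finset.sum_congr rfl fun k _ => (hT.map_smul _ _ (heN k)).symm
    have ht3 : ∑ k ∈ Finset.range n, (((k : ℝ) + 1) * k) • t k = ((n : ℝ) * m) • T (a * a) := by
      rw [← hT.map_smul _ _ (hN.sq_mem a ha.1), ← hs2,
        hT.map_sum _ _ fun k _ => N.smul_mem _ (heN k)]
      exact Finset.sum_congr rfl fun k _ => (hT.map_smul _ _ (heN k)).symm
    -- This is the conjugate of t k ≥ 0 by (k + 1) - n T(a), expanded with (k + 1)² = (k + 1) k + (k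
    -- + 1). Summing over k and using ∑ t k ≤ 1 yields n² T(a)² ≤ n (n - 1) T(a²) + n T(a).
    have hterm : ∀ k : ℕ, 0 ≤ (((k : ℝ) + 1) * k) • t k + ((k : ℝ) + 1) • t k
        - (n : ℝ) • (T a * (((k : ℝ) + 1) • t k)) - (n : ℝ) • ((((k : ℝ) + 1) • t k) * T a)
        + ((n : ℝ) * n) • (T a * t k * T a) := by
      intro k
      have h := star_left_conjugate_nonneg (ht0 k) (((k : ℝ) + 1) • 1 - (n : ℝ) • T a)
      have hstar : star (((k : ℝ) + 1) • (1 : H →L[ℂ] H) - (n : ℝ) • T a) =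
          ((k : ℝ) + 1) • 1 - (n : ℝ) • T a := by
        simp [hsa.star_eq]
      rw [hstar] at h
      convert h using 1
      simp only [sub_mul, mul_sub, smul_mul_assoc, mul_smul_comm, one_mul, mul_one, smul_sub,
        smul_smul, mul_assoc]
      module
    have hsum := Finset.sum_nonneg fun k (_ : k ∈ Finset.range n) => hterm k
    simp only [Finset.sum_add_distrib, Finset.sum_sub_distrib, ← Finset.smul_sum,
      ← Finset.mul_sum, ← Finset.sum_mul, ht2, ht3] at hsum
    have hcon : T a * (∑ k ∈ Finset.range n, t k) * T a ≤ T a * T a := by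
      have := star_left_conjugate_le_conjugate ht1 (T a)
      rwa [hsa.star_eq, mul_one] at this
    have hnn : (0 : ℝ) < n := by rw [hn]; positivity
    have h1 : ((n : ℝ) * n) • (T a * T a) ≤ ((n : ℝ) * n) • (T (a * a) + (n : ℝ)⁻¹ • T a) := by
      have h2 := smul_le_smul_of_nonneg_left hcon (mul_pos hnn hnn).le
      have h3 : 0 ≤ (n : ℝ) • T (a * a) := smul_nonneg hnn.le hTaa
      have h4 : ((n : ℝ) * n) • (T (a * a) + (n : ℝ)⁻¹ • T a) =
          ((n : ℝ) * m) • T (a * a) + (n : ℝ) • T (a * a) + (n : ℝ) • T a := by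
        rw [smul_add, smul_smul, mul_assoc, mul_inv_cancel₀ hnn.ne', mul_one, hn]
        push_cast
        module
      rw [h4, ← sub_nonneg]
      have h5 := add_nonneg (add_nonneg hsum (sub_nonneg.2 h2)) h3
      convert h5 using 1
      simp only [smul_mul_assoc, mul_smul_comm, smul_smul]
      module
    have h6 := smul_le_smul_of_nonneg_left h1 (inv_nonneg.2 (mul_pos hnn hnn).le)
    rw [smul_smul, smul_smul, inv_mul_cancel₀ (mul_pos hnn hnn).ne', one_smul, one_smul] at h6
    simpa [hn] using h6
  refine ge_of_tendsto_apply (l := atTop) (Eventually.of_forall key) fun x => ?_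
  have h1 : Tendsto (fun n : ℕ => ((n : ℝ) + 1)⁻¹) atTop (𝓝 0) := by
    simpa [one_div] using tendsto_one_div_add_atTop_nhds_zero_nat (𝕜 := ℝ)
  simpa using (h1.smul_const (T a x)).const_add (T (a * a) x)

/-- **Kadison's inequality** for positive unital maps of Jordan algebras of operators. -/
theorem map_mul_self_le {a : H →L[ℂ] H} (ha : a ∈ N) : T a * T a ≤ T (a * a) := by
  set r := ‖a‖ + 1 with hr
  have hr0 : 0 < r := by positivity
  set e := (2 * r)⁻¹ • (a + r • u) with he
  have hee : e ∈ effectsIn N := hN.affine_mem_effectsIn ha hr0 (by linarith)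
  have heN := hee.1
  have hae : a = (2 * r) • e - r • u := by
    rw [he, smul_smul, mul_inv_cancel₀ (by positivity), one_smul, add_sub_cancel_right]
  have hTe := hT.map_mem e heN
  have hTa : T a = (2 * r) • T e - r • u := by
    rw [hae, hT.map_sub (N.smul_mem _ heN) (N.smul_mem _ hN.unit_mem), hT.map_smul _ _ heN,
      hT.map_smul _ _ hN.unit_mem, hT.map_unit]
  have hexp : ∀ x ∈ N, ((2 * r) • x - r • u) * ((2 * r) • x - r • u) =
      (4 * r ^ 2) • (x * x) + (r ^ 2 • u - (4 * r ^ 2) • x) := by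
    intro x hx
    simp only [sub_mul, mul_sub, smul_mul_assoc, mul_smul_comm, hN.unit_mul x hx,
      hN.mul_unit hx, hN.unit_mul u hN.unit_mem]
    module
  have hee2 := hN.sq_mem e heN
  rw [hTa, hae, hexp e heN, hexp _ hTe, hT.map_add _ (N.smul_mem _ hee2) _
    (N.sub_mem (N.smul_mem _ hN.unit_mem) (N.smul_mem _ heN)), hT.map_sub
    (N.smul_mem _ hN.unit_mem) (N.smul_mem _ heN), hT.map_smul _ _ hee2, hT.map_smul _ _ heN,
    hT.map_smul _ _ hN.unit_mem, hT.map_unit]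
  gcongr
  exact hT.map_mul_self_le_of_effect hN hee

/-- Cauchy-Schwarz: T((x + t n)²) ≥ 0 is affine in t when T(n²) = 0, so its slope vanishes. -/
theorem map_mul_add_mul_eq_zero {n x : H →L[ℂ] H} (hn : n ∈ N) (hx : x ∈ N)
    (h : T (n * n) = 0) : T (n * x + x * n) = 0 := by
  refine eq_zero_of_forall_nonneg_add_smul (A := T (x * x)) fun t => ?_
  have hxn := hN.mul_add_mul_mem hn hx
  have hmem := N.add_mem hx (N.smul_mem t hn)
  have h1 := hT.map_nonneg _ (hN.sq_mem _ hmem) (nonneg_mul_self (hN.isSelfAdjoint _ hmem))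
  have h2 : (x + t • n) * (x + t • n) = x * x + t • (n * x + x * n) + (t * t) • (n * n) := by
    simp only [add_mul, mul_add, smul_mul_assoc, mul_smul_comm]
    module
  rwa [h2, hT.map_add _ (N.add_mem (hN.sq_mem _ hx) (N.smul_mem _ hxn)) _
    (N.smul_mem _ (hN.sq_mem _ hn)), hT.map_add _ (hN.sq_mem _ hx) _ (N.smul_mem _ hxn),
    hT.map_smul _ _ hxn, hT.map_smul _ _ (hN.sq_mem _ hn), h, smul_zero, add_zero] at h1

end IsPositiveUnitalOn

end PositiveMaps

/-! ### Fixed points of a faithful positive idempotent -/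

section FaithfulProjections

variable {H : Type*} [NormedAddCommGroup H] [InnerProductSpace ℂ H] [CompleteSpace H]

/-- `M` restricts to a faithful positive unital idempotent linear map on `N`. -/
structure IsFaithfulProjectionOn (N : Submodule ℝ (H →L[ℂ] H)) (u : H →L[ℂ] H)
    (M : (H →L[ℂ] H) → H →L[ℂ] H) : Prop extends IsPositiveUnitalOn N u M where
  idem : ∀ a ∈ N, M (M a) = M a
  faithful : ∀ a ∈ N, 0 ≤ a → M a = 0 → a = 0

namespace IsFaithfulProjectionOn

variable {N : Submodule ℝ (H →L[ℂ] H)} {u : H →L[ℂ] H} {M : (H →L[ℂ] H) → H →L[ℂ] H}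
  (hM : IsFaithfulProjectionOn N u M)

/-- The fixed points of `M` in `N`. -/
def fixedPoints : Submodule ℝ (H →L[ℂ] H) where
  carrier := {a | a ∈ N ∧ M a = a}
  add_mem' {a b} ha hb := ⟨N.add_mem ha.1 hb.1, by rw [hM.map_add a ha.1 b hb.1, ha.2, hb.2]⟩
  zero_mem' := ⟨N.zero_mem, hM.map_zero⟩
  smul_mem' c a ha := ⟨N.smul_mem c ha.1, by rw [hM.map_smul c a ha.1, ha.2]⟩

variable (hN : IsMonotoneClosedJordan N u)
include hM hN

/-- Kadison gives M(a²) - a² ≥ 0; idempotence shows that M kills this element, and faithfulness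
makes it zero. -/
theorem map_mul_self {a : H →L[ℂ] H} (ha : a ∈ N) (hfix : M a = a) : M (a * a) = a * a := by
  have h1 := hM.map_mul_self_le hN ha
  rw [hfix] at h1
  have h2 := hN.sq_mem a ha
  have h3 := hM.map_mem _ h2
  have h4 : M (M (a * a) - a * a) = 0 := by
    rw [hM.map_sub h3 h2, hM.idem _ h2, sub_self]
  exact sub_eq_zero.1 (hM.faithful _ (N.sub_mem h3 h2) (sub_nonneg.2 h1) h4)

/-- In Kadison's inequality at x + t a the t² terms cancel by `map_mul_self`. What remains is affine
in t and nonnegative for all real t, so its slope, the difference of the two sides, is zero. -/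
theorem map_mul_add_mul {a x : H →L[ℂ] H} (ha : a ∈ N) (hfix : M a = a) (hx : x ∈ N) :
    M (a * x + x * a) = a * M x + M x * a := by
  rw [← sub_eq_zero]
  refine eq_zero_of_forall_nonneg_add_smul (A := M (x * x) - M x * M x) fun t => ?_
  have hax := hN.mul_add_mul_mem ha hx
  have h1 := hM.map_mul_self_le hN (N.add_mem hx (N.smul_mem t ha))
  have h2 : ∀ y : H →L[ℂ] H, (y + t • a) * (y + t • a) =
      y * y + t • (a * y + y * a) + (t * t) • (a * a) := fun y => by
    simp only [add_mul, mul_add, smul_mul_assoc, mul_smul_comm]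
    module
  rw [hM.map_add _ hx _ (N.smul_mem _ ha), hM.map_smul _ _ ha, hfix, h2, h2,
    hM.map_add _ (N.add_mem (hN.sq_mem _ hx) (N.smul_mem _ hax)) _
    (N.smul_mem _ (hN.sq_mem _ ha)), hM.map_add _ (hN.sq_mem _ hx) _ (N.smul_mem _ hax),
    hM.map_smul _ _ hax, hM.map_smul _ _ (hN.sq_mem _ ha), hM.map_mul_self hN ha hfix,
    ← sub_nonneg] at h1
  convert h1 using 1
  module

theorem map_conj {a b : H →L[ℂ] H} (ha : a ∈ N) (hfix : M a = a) (hb : b ∈ N) :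
    M (a * b * a) = a * M b * a := by
  have hab := hN.mul_add_mul_mem ha hb
  have haa := hN.sq_mem a ha
  have h1 : ∀ y : H →L[ℂ] H, a * y * a =
      (1 / 2 : ℝ) • ((a * (a * y + y * a) + (a * y + y * a) * a) - (a * a * y + y * (a * a))) := by
    intro y
    have : a * (a * y + y * a) + (a * y + y * a) * a - (a * a * y + y * (a * a))
        = (2 : ℝ) • (a * y * a) := by
      rw [two_smul]
      noncomm_ring
    rw [this, smul_smul]
    norm_num
  have h2 := hN.mul_add_mul_mem ha hab
  have h3 := hN.mul_add_mul_mem haa hb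
  rw [h1 b, hM.map_smul _ _ (N.sub_mem h2 h3), hM.map_sub h2 h3, hM.map_mul_add_mul hN ha hfix hab,
    hM.map_mul_add_mul hN ha hfix hb,
    hM.map_mul_add_mul hN haa (hM.map_mul_self hN ha hfix) hb, ← h1]

theorem isMonotoneClosedJordan_fixedPoints (hnormal : IsNormalOn N M) :
    IsMonotoneClosedJordan hM.fixedPoints u where
  isSelfAdjoint a ha := hN.isSelfAdjoint a ha.1
  sq_mem a ha := ⟨hN.sq_mem a ha.1, hM.map_mul_self hN ha.1 ha.2⟩
  isClosed := by
    refine isClosed_of_closure_subset fun a ha => ?_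
    obtain ⟨f, hf, hlim⟩ := mem_closure_iff_seq_limit.1 ha
    have haN : a ∈ N := hN.isClosed.mem_of_tendsto hlim (Eventually.of_forall fun n => (hf n).1)
    refine ⟨haN, ?_⟩
    have hr : Tendsto (fun n => ‖a - f n‖) atTop (𝓝 0) := by
      simpa using (hlim.const_sub a).norm
    have happ : ∀ (c : ℝ) (x : H), Tendsto (fun n => (f n + (c * ‖a - f n‖) • u) x) atTop
        (𝓝 (a x)) := by
      intro c x
      have h1 := ((ContinuousLinearMap.apply ℂ H x).continuous.tendsto a).comp hlim
      simpa using h1.add ((hr.const_mul c).smul_const (u x))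
    -- Norm closedness is obtained from order bounds: ±(a - f n) ≤ ‖a - f n‖ u is preserved by M.
    have hbound : ∀ n, ∀ d ∈ N, d ≤ ‖a - f n‖ • u → M d ≤ ‖a - f n‖ • u := fun n d hd hle => by
      have := hM.mono hd (N.smul_mem _ hN.unit_mem) hle
      rwa [hM.map_smul _ _ hN.unit_mem, hM.map_unit] at this
    refine le_antisymm ?_ ?_
    · refine ge_of_tendsto_apply (l := atTop) (Eventually.of_forall fun n => ?_) (happ 1)
      have h1 := hbound n _ (N.sub_mem haN (hf n).1)
        (hN.le_norm_smul_unit (N.sub_mem haN (hf n).1))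
      rw [hM.map_sub haN (hf n).1, (hf n).2] at h1
      rw [one_mul]
      exact sub_le_iff_le_add'.1 h1
    · refine le_of_tendsto_apply (l := atTop) (Eventually.of_forall fun n => ?_) (happ (-1))
      have h0 := hN.le_norm_smul_unit (N.sub_mem (hf n).1 haN)
      rw [norm_sub_rev] at h0
      have h1 := hbound n _ (N.sub_mem (hf n).1 haN) h0
      rw [hM.map_sub (hf n).1 haN, (hf n).2] at h1
      rw [neg_one_mul, neg_smul, ← sub_eq_add_neg]
      exact sub_le_comm.1 h1
  unit_mem := ⟨hN.unit_mem, hM.map_unit⟩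
  unit_mul a ha := hN.unit_mul a ha.1
  sup_mem D hD hne hdir s hs := by
    have hDN : D ⊆ effectsIn N := fun d hd => ⟨(hD hd).1.1, (hD hd).2⟩
    refine ⟨hN.sup_mem D hDN hne hdir s hs, ?_⟩
    have h1 := hnormal D hDN hne hdir s hs
    have h2 : M '' D = D := by
      rw [Set.image_congr (g := id) fun d hd => (hD hd).1.2, Set.image_id]
    rw [h2] at h1
    exact h1.unique hs

end IsFaithfulProjectionOn

end FaithfulProjections

/-! ### The null projection of a normal positive idempotent -/

section NullProjection

variable {H : Type*} [NormedAddCommGroup H] [InnerProductSpace ℂ H] [CompleteSpace H]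

/-- `p` is the largest projection of `N` annihilated by the positive unital idempotent `T`. -/
structure IsNullProjection (N : Submodule ℝ (H →L[ℂ] H)) (u : H →L[ℂ] H)
    (T : (H →L[ℂ] H) → H →L[ℂ] H) (p : H →L[ℂ] H) : Prop extends IsPositiveUnitalOn N u T where
  idem : ∀ a ∈ N, T (T a) = T a
  isStarProjection : IsStarProjection p
  mem : p ∈ N
  map_eq_zero : T p = 0
  mul_eq_self : ∀ a ∈ N, 0 ≤ a → T a = 0 → a * p = a ∧ p * a = a

theorem IsPositiveUnitalOn.exists_isNullProjection {N : Submodule ℝ (H →L[ℂ] H)}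
    {u : H →L[ℂ] H} {T : (H →L[ℂ] H) → H →L[ℂ] H} (hT : IsPositiveUnitalOn N u T)
    (hN : IsMonotoneClosedJordan N u) (hidem : ∀ a ∈ N, T (T a) = T a) (hnormal : IsNormalOn N T) :
    ∃ p, IsNullProjection N u T p := by
  obtain ⟨p, hp, hpF⟩ := hN.exists_isGreatest_projection (F := {a ∈ effectsIn N | T a = 0})
    (fun a ha => ha.1) ⟨0, hN.zero_mem_effectsIn, hT.map_zero⟩ (by
      intro y hy a ha n han
      refine ⟨ha, le_antisymm ?_ (hT.map_nonneg a ha.1 ha.2.1)⟩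
      have := hT.mono ha.1 (N.smul_mem _ hy.1.1) han
      rwa [hT.map_smul _ _ hy.1.1, hy.2, smul_zero] at this) (by
      intro y hy z hz
      refine ⟨midpoint_mem_effectsIn hy.1 hz.1, ?_⟩
      rw [hT.map_smul _ _ (N.add_mem hy.1.1 hz.1.1), hT.map_add _ hy.1.1 _ hz.1.1, hy.2, hz.2,
        add_zero, smul_zero]) (by
      intro D hD hne hdir s hs
      have hDN : D ⊆ effectsIn N := fun d hd => (hD hd).1
      refine ⟨hN.sup_mem_effectsIn hDN hne hdir hs, ?_⟩
      have h1 := hnormal D hDN hne hdir s hs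
      have h2 : T '' D = {0} := by
        rw [Set.image_congr (g := fun _ => 0) fun d hd => (hD hd).2, hne.image_const]
      rw [h2] at h1
      exact h1.unique isLUB_singleton)
  refine ⟨p, hT, hidem, hp, hpF.1.1.1, hpF.1.2, fun a ha ha0 hTa => ?_⟩
  have hr : 0 < (‖a‖ + 1)⁻¹ := by positivity
  have haN := N.smul_mem (‖a‖ + 1)⁻¹ ha
  have ha0' := smul_nonneg hr.le ha0
  have heff : (‖a‖ + 1)⁻¹ • a ∈ effectsIn N := by
    refine ⟨haN, ha0', (CStarAlgebra.norm_le_one_iff_of_nonneg _ ha0').1 ?_⟩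
    rw [norm_smul, Real.norm_of_nonneg hr.le]
    exact (inv_mul_le_one₀ (by positivity)).2 (by linarith)
  have hle : (‖a‖ + 1)⁻¹ • a ≤ (1 : ℝ) • p := by
    rw [one_smul]
    exact hpF.2 ⟨heff, by rw [hT.map_smul _ _ ha, hTa, smul_zero]⟩
  obtain ⟨h1, h2⟩ := mul_eq_self_of_le_smul ha0' heff.2.2 hp hle
  rw [smul_mul_assoc] at h1
  rw [mul_smul_comm] at h2
  exact ⟨smul_right_injective _ hr.ne' h1, smul_right_injective _ hr.ne' h2⟩

namespace IsNullProjection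

variable {N : Submodule ℝ (H →L[ℂ] H)} {u : H →L[ℂ] H} {T : (H →L[ℂ] H) → H →L[ℂ] H}
  {p : H →L[ℂ] H} (hT : IsNullProjection N u T p) (hN : IsMonotoneClosedJordan N u)
include hT hN

theorem map_mul_add_mul {x : H →L[ℂ] H} (hx : x ∈ N) : T (p * x + x * p) = 0 :=
  hT.map_mul_add_mul_eq_zero hN hT.mem hx
    (by rw [hT.isStarProjection.isIdempotentElem.eq, hT.map_eq_zero])

/-- Apply `map_mul_add_mul` to y = p x + x p: the element p y + y p equals y + 2 p x p, and T
already kills y. -/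
theorem map_conj {x : H →L[ℂ] H} (hx : x ∈ N) : T (p * x * p) = 0 := by
  have hpp := hT.isStarProjection.isIdempotentElem.eq
  have hpx := hN.mul_add_mul_mem hT.mem hx
  have h1 : (p * (p * x + x * p) + (p * x + x * p) * p) =
      (p * x + x * p) + (2 : ℝ) • (p * x * p) := by
    rw [two_smul, mul_add, add_mul, ← mul_assoc, hpp, mul_assoc x p p, hpp, mul_assoc p x p]
    abel
  have h2 := hT.map_mul_add_mul hN hpx
  rw [h1, hT.map_add _ hpx _ (N.smul_mem _ (hN.conj_mem hT.mem hx)), hT.map_mul_add_mul hN hx,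
    zero_add, hT.map_smul _ _ (hN.conj_mem hT.mem hx)] at h2
  exact (smul_eq_zero.1 h2).resolve_left two_ne_zero

theorem unit_sub_mem : u - p ∈ N := N.sub_mem hN.unit_mem hT.mem

theorem unit_sub_mul_unit_sub : (u - p) * (u - p) = u - p := by
  rw [sub_mul, mul_sub, mul_sub, hN.unit_mul u hN.unit_mem, hN.unit_mul p hT.mem,
    hN.mul_unit hT.mem, hT.isStarProjection.isIdempotentElem.eq]
  abel

theorem unit_sub_mul : (u - p) * p = 0 := by
  rw [sub_mul, hN.unit_mul p hT.mem, hT.isStarProjection.isIdempotentElem.eq, sub_self]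

theorem mul_unit_sub : p * (u - p) = 0 := by
  rw [mul_sub, hN.mul_unit hT.mem, hT.isStarProjection.isIdempotentElem.eq, sub_self]

theorem unit_sub_conj_eq {x : H →L[ℂ] H} (hx : x ∈ N) :
    (u - p) * x * (u - p) = x - (p * x + x * p) + p * x * p := by
  rw [sub_mul, hN.unit_mul x hx, mul_sub, sub_mul, sub_mul, hN.mul_unit hx, mul_assoc p x u,
    hN.mul_unit hx]
  abel

theorem map_unit_sub_conj {x : H →L[ℂ] H} (hx : x ∈ N) : T ((u - p) * x * (u - p)) = T x := by
  have hpx := hN.mul_add_mul_mem hT.mem hx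
  rw [hT.unit_sub_conj_eq hN hx, hT.map_add _ (N.sub_mem hx hpx) _ (hN.conj_mem hT.mem hx),
    hT.map_sub hx hpx, hT.map_mul_add_mul hN hx, hT.map_conj hN hx, sub_zero, add_zero]

/-- The fixed points of `T` commute with its null projection. -/
theorem mul_comm_of_fixed {b : H →L[ℂ] H} (hb : b ∈ N) (hfix : T b = b) : p * b = b * p := by
  have heN := hT.unit_sub_mem hN
  have hee := hT.unit_sub_mul_unit_sub hN
  have hsa := hN.isSelfAdjoint
  set e := u - p with he
  have hxN : e * b * e ∈ N := hN.conj_mem heN hb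
  have hbb := hN.sq_mem b hb
  -- The off-diagonal block p b e need not lie in N, but its square modulus does.
  have hd : star (p * b * e) * (p * b * e) = e * (b * b) * e - e * b * e * (e * b * e) := by
    have h1 : p = u - e := by rw [he, sub_sub_cancel]
    rw [star_mul, star_mul, (hsa _ heN).star_eq, (hsa _ hb).star_eq, (hsa _ hT.mem).star_eq]
    calc e * (b * p) * (p * b * e) = e * b * (p * p) * b * e := by simp only [mul_assoc]
      _ = e * b * (u - e) * b * e := by rw [hT.isStarProjection.isIdempotentElem.eq, h1]
      _ = e * (b * u) * b * e - e * b * e * b * e := by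
          simp only [mul_sub, sub_mul, mul_assoc]
      _ = e * (b * b) * e - e * b * (e * e) * b * e := by
          rw [hN.mul_unit hb, hee]
          simp only [mul_assoc]
      _ = _ := by simp only [mul_assoc]
  have hdN : star (p * b * e) * (p * b * e) ∈ N :=
    hd ▸ N.sub_mem (hN.conj_mem heN hbb) (hN.sq_mem _ hxN)
  have hd0 := star_mul_self_nonneg (p * b * e)
  have hkad := hT.map_mul_self_le hN hxN
  rw [hT.map_unit_sub_conj hN hb, hfix] at hkad
  -- Since T(e b e) = b, Kadison at e b e gives b² ≤ T((e b e)²). A second application of T kills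
  -- the bound T(b²) - b², so by idempotence T annihilates the square modulus.
  have hTd : T (star (p * b * e) * (p * b * e)) ≤ T (b * b) - b * b := by
    rw [hd, hT.map_sub (hN.conj_mem heN hbb) (hN.sq_mem _ hxN), hT.map_unit_sub_conj hN hbb]
    exact sub_le_sub_left hkad _
  have hTbb := hT.map_mem _ hbb
  have h1 := hT.mono (hT.map_mem _ hdN) (N.sub_mem hTbb hbb) hTd
  rw [hT.idem _ hdN, hT.map_sub hTbb hbb, hT.idem _ hbb, sub_self] at h1
  -- A positive element killed by T is supported on p, whereas this one is supported on e; hence it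
  -- is zero.
  have h2 := (hT.mul_eq_self _ hdN hd0 (le_antisymm h1 (hT.map_nonneg _ hdN hd0))).1
  have h3 : star (p * b * e) * (p * b * e) = 0 := by
    rw [← h2]
    simp only [mul_assoc]
    rw [hT.unit_sub_mul hN]
    simp
  have h4 : p * b * e = 0 := CStarRing.star_mul_self_eq_zero_iff _ |>.1 h3
  rw [he, mul_sub, mul_assoc p b u, hN.mul_unit hb, sub_eq_zero] at h4
  have h5 := congrArg star h4
  simp only [star_mul, (hsa _ hb).star_eq, (hsa _ hT.mem).star_eq] at h5
  rw [h4, h5, mul_assoc]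

/-- A fixed point of `T` is block diagonal with respect to the null projection. -/
theorem eq_add_of_fixed {b : H →L[ℂ] H} (hb : b ∈ N) (hfix : T b = b) :
    (u - p) * b * (u - p) + p * b * p = b := by
  have h1 := hT.mul_comm_of_fixed hN hb hfix
  have h2 : p * b * p = p * b := by
    rw [mul_assoc, ← h1, ← mul_assoc, hT.isStarProjection.isIdempotentElem.eq]
  rw [hT.unit_sub_conj_eq hN hb, h2, ← h1]
  abel

end IsNullProjection

end NullProjection

/-! ### The faithful part of T and its fixed points -/

section FaithfulPart

variable {H : Type*} [NormedAddCommGroup H] [InnerProductSpace ℂ H] [CompleteSpace H]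

/-- The map `a ↦ (1 - p) T(a) (1 - p) + p a p` attached to a map `T` with null projection `p`. -/
def faithfulPart (u p : H →L[ℂ] H) (T : (H →L[ℂ] H) → H →L[ℂ] H) (a : H →L[ℂ] H) : H →L[ℂ] H :=
  (u - p) * T a * (u - p) + p * a * p

namespace IsNullProjection

variable {N : Submodule ℝ (H →L[ℂ] H)} {u : H →L[ℂ] H} {T : (H →L[ℂ] H) → H →L[ℂ] H}
  {p : H →L[ℂ] H} (hT : IsNullProjection N u T p) (hN : IsMonotoneClosedJordan N u)
include hT hN

theorem unit_sub_conj_mem {a : H →L[ℂ] H} (ha : a ∈ N) : (u - p) * T a * (u - p) ∈ N :=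
  hN.conj_mem (hT.unit_sub_mem hN) (hT.map_mem a ha)

/-- T ignores both the corner of p and the compression by u - p. This is the factorization τ = φ ∘ μ
at the level of T. -/
theorem map_faithfulPart {a : H →L[ℂ] H} (ha : a ∈ N) : T (faithfulPart u p T a) = T a := by
  rw [faithfulPart, hT.map_add _ (hT.unit_sub_conj_mem hN ha) _ (hN.conj_mem hT.mem ha),
    hT.map_conj hN ha, add_zero, hT.map_unit_sub_conj hN (hT.map_mem a ha), hT.idem a ha]

theorem isPositiveUnitalOn_faithfulPart : IsPositiveUnitalOn N u (faithfulPart u p T) where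
  map_mem a ha := N.add_mem (hT.unit_sub_conj_mem hN ha) (hN.conj_mem hT.mem ha)
  map_add a ha b hb := by
    simp only [faithfulPart, hT.map_add a ha b hb, mul_add, add_mul]
    abel
  map_smul c a ha := by
    simp only [faithfulPart, hT.map_smul c a ha, mul_smul_comm, smul_mul_assoc, smul_add]
  map_nonneg a ha ha0 := by
    have h1 := star_left_conjugate_nonneg (hT.map_nonneg a ha ha0) (u - p)
    rw [(hN.isSelfAdjoint _ (hT.unit_sub_mem hN)).star_eq] at h1
    have h2 := star_left_conjugate_nonneg ha0 p
    rw [hT.isStarProjection.isSelfAdjoint.star_eq] at h2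
    exact add_nonneg h1 h2
  map_unit := by
    rw [faithfulPart, hT.map_unit, hN.mul_unit (hT.unit_sub_mem hN), hT.unit_sub_mul_unit_sub hN,
      hN.mul_unit hT.mem, hT.isStarProjection.isIdempotentElem.eq, sub_add_cancel]

theorem isFaithfulProjectionOn_faithfulPart :
    IsFaithfulProjectionOn N u (faithfulPart u p T) where
  toIsPositiveUnitalOn := hT.isPositiveUnitalOn_faithfulPart hN
  idem a ha := by
    have hpp := hT.isStarProjection.isIdempotentElem.eq
    have h1 : p * faithfulPart u p T a * p = p * a * p := by
      rw [faithfulPart, mul_add, add_mul, ← mul_assoc, ← mul_assoc, hT.mul_unit_sub hN, zero_mul,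
        zero_mul, zero_mul, zero_add, ← mul_assoc, ← mul_assoc, hpp, mul_assoc (p * a), hpp]
    rw [faithfulPart, hT.map_faithfulPart hN ha, h1, faithfulPart]
  faithful a ha ha0 h := by
    have h1 := star_left_conjugate_nonneg (hT.map_nonneg a ha ha0) (u - p)
    rw [(hN.isSelfAdjoint _ (hT.unit_sub_mem hN)).star_eq] at h1
    have h2 := star_left_conjugate_nonneg ha0 p
    rw [hT.isStarProjection.isSelfAdjoint.star_eq] at h2
    obtain ⟨-, h4⟩ := (add_eq_zero_iff_of_nonneg h1 h2).1 h
    -- Now a is supported on p, so a = p a p, and this block vanishes by `h4`.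
    have h5 : T a = 0 := by rw [← hT.map_faithfulPart hN ha, h, hT.map_zero]
    obtain ⟨h6, h7⟩ := hT.mul_eq_self a ha ha0 h5
    rwa [h7, h6] at h4

theorem isNormalOn_faithfulPart (hnormal : IsNormalOn N T) :
    IsNormalOn N (faithfulPart u p T) := by
  intro D hD hne hdir s hs
  have hM := hT.isPositiveUnitalOn_faithfulPart hN
  refine isLUB_image_of_tendsto_apply hne hdir
    (fun a ha b hb hab => hM.mono (hD ha).1 (hD hb).1 hab) fun x => ?_
  have h1 := tendsto_apply_of_isLUB_image hne hdir
    (fun a ha b hb hab => hT.mono (hD ha).1 (hD hb).1 hab)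
    (fun d hd => (hT.map_mem_effectsIn hN (hD hd)).2) (hnormal D hD hne hdir s hs) ((u - p) x)
  have h2 := tendsto_apply_of_isLUB hne hdir (fun d hd => (hD hd).2) hs (p x)
  exact (((u - p).continuous.tendsto _).comp h1).add ((p.continuous.tendsto _).comp h2)

theorem faithfulPart_eq_of_fixed {b : H →L[ℂ] H} (hb : b ∈ N) (hfix : T b = b) :
    faithfulPart u p T b = b := by
  rw [faithfulPart, hfix, hT.eq_add_of_fixed hN hb hfix]

theorem faithfulPart_sub_map {a : H →L[ℂ] H} (ha : a ∈ N) :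
    faithfulPart u p T a - T a = p * (a - T a) * p := by
  have h := hT.eq_add_of_fixed hN (hT.map_mem a ha) (hT.idem a ha)
  rw [faithfulPart, eq_sub_of_add_eq h, mul_sub p, sub_mul]
  abel

theorem map_corner_mul_add_mul {c x : H →L[ℂ] H} (hc : c ∈ N) (hx : x ∈ N) :
    T ((p * c * p) * x + x * (p * c * p)) = 0 := by
  have hpcp := hN.conj_mem hT.mem hc
  refine hT.map_mul_add_mul_eq_zero hN hpcp hx ?_
  have h := hT.map_conj hN (hN.sq_mem _ hpcp)
  have hpp := hT.isStarProjection.isIdempotentElem.eq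
  have h2 : p * (p * c * p * (p * c * p)) * p = p * c * p * (p * c * p) := by
    have h3 : p * (p * c * p) = p * c * p := by rw [← mul_assoc, ← mul_assoc, hpp]
    have h4 : p * c * p * p = p * c * p := by rw [mul_assoc (p * c), hpp]
    rw [← mul_assoc p, h3, mul_assoc (p * c * p), h4]
  rwa [h2] at h

/-- The fixed points of the faithful part of `T` are the `a` with `T(a²) = T(T(a)²)`. -/
theorem faithfulPart_eq_self_iff {a : H →L[ℂ] H} (ha : a ∈ N) :
    faithfulPart u p T a = a ↔ T (a * a) = T (T a * T a) := by
  have hM := hT.isFaithfulProjectionOn_faithfulPart hN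
  have hb := hT.map_mem a ha
  have hsub := N.sub_mem ha hb
  have hMa := hT.faithfulPart_sub_map hN ha
  have hMb := hT.faithfulPart_eq_of_fixed hN hb (hT.idem a ha)
  have hcross := hT.map_corner_mul_add_mul hN hsub hb
  have hpp := hT.isStarProjection.isIdempotentElem.eq
  have hn := hN.conj_mem hT.mem hsub
  have hee := hT.unit_sub_mul_unit_sub hN
  have haa := hN.sq_mem a ha
  have hbb := hN.sq_mem _ hb
  set b := T a with hbdef
  constructor
  · intro h
    rw [h] at hMa
    have h1 : T ((p * (a - b) * p) * (p * (a - b) * p)) = 0 := by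
      have h2 : p * (a - b) * p * (p * (a - b) * p) =
          p * ((p * (a - b) * p) * (p * (a - b) * p)) * p := by
        have h3 : p * (p * (a - b) * p) = p * (a - b) * p := by rw [← mul_assoc, ← mul_assoc, hpp]
        have h4 : p * (a - b) * p * p = p * (a - b) * p := by rw [mul_assoc (p * (a - b)), hpp]
        rw [← mul_assoc p (p * (a - b) * p), h3, mul_assoc (p * (a - b) * p)
          (p * (a - b) * p) p, h4]
      rw [h2]
      exact hT.map_conj hN (hN.sq_mem _ hn)
    set n := p * (a - b) * p with hndef
    have h2 : a * a = b * b + (n * b + b * n) + n * n := by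
      rw [← hMa]
      noncomm_ring
    rw [h2, hT.map_add _ (N.add_mem hbb (hN.mul_add_mul_mem hn hb)) _ (hN.sq_mem _ hn),
      hT.map_add _ hbb _ (hN.mul_add_mul_mem hn hb), hcross, h1, add_zero, add_zero]
  · intro h
    have hab := hN.mul_add_mul_mem hb ha
    -- Replace T by T ∘ M and use that b is fixed by M: a becomes M(a) = b + p (a - b) p, whose
    -- corner term contributes nothing under T.
    have h1 : T (b * a + a * b) = T (b * b) + T (b * b) := by
      rw [← hT.map_faithfulPart hN hab, hM.map_mul_add_mul hN hb hMb ha, sub_eq_iff_eq_add.1 hMa]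
      have h2 : b * (p * (a - b) * p + b) + (p * (a - b) * p + b) * b =
          (p * (a - b) * p * b + b * (p * (a - b) * p)) + (b * b + b * b) := by
        noncomm_ring
      rw [h2, hT.map_add _ (hN.mul_add_mul_mem hn hb) _ (N.add_mem hbb hbb), hcross, zero_add,
        hT.map_add _ hbb _ hbb]
    have h2 : (a - b) * (a - b) = a * a - (b * a + a * b) + b * b := by noncomm_ring
    -- Hence (a - b)² is supported on p, and so is a - b itself, giving a - b = p (a - b) p.
    have h3 : T ((a - b) * (a - b)) = 0 := by
      rw [h2, hT.map_add _ (N.sub_mem haa hab) _ hbb, hT.map_sub haa hab, h1, h]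
      abel
    have hsa := hN.isSelfAdjoint _ hsub
    have h4 := (hT.mul_eq_self _ (hN.sq_mem _ hsub) (nonneg_mul_self hsa) h3).1
    have heN := hT.unit_sub_mem hN
    have h5 : (a - b) * (u - p) = 0 := by
      rw [← CStarRing.star_mul_self_eq_zero_iff, star_mul, hsa.star_eq,
        (hN.isSelfAdjoint _ heN).star_eq, mul_assoc, ← mul_assoc (a - b), mul_sub, h4,
        hN.mul_unit (hN.sq_mem _ hsub), sub_self, mul_zero]
    rw [mul_sub, hN.mul_unit hsub, sub_eq_zero] at h5
    have h6 := congrArg star h5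
    rw [star_mul, hsa.star_eq, hT.isStarProjection.isSelfAdjoint.star_eq] at h6
    rw [mul_assoc, ← h5, ← h6] at hMa
    exact sub_left_inj.1 hMa

end IsNullProjection

end FaithfulPart

/-! ### Linear extension of unital additive maps -/

section Extension

variable {H : Type*} [NormedAddCommGroup H] [InnerProductSpace ℂ H] [CompleteSpace H]

/-- `t` restricts to a unital additive map on the effects of `N`. -/
structure IsUnitalAdditiveOn (N : Submodule ℝ (H →L[ℂ] H)) (u : H →L[ℂ] H)
    (t : (H →L[ℂ] H) → H →L[ℂ] H) : Prop where
  map_mem : ∀ a ∈ effectsIn N, t a ∈ effectsIn N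
  map_add : ∀ a ∈ effectsIn N, ∀ b ∈ effectsIn N, a + b ∈ effectsIn N → t (a + b) = t a + t b
  map_unit : t u = u

/-- The linear extension of a unital additive map of effects. -/
noncomputable def linearExtension (u : H →L[ℂ] H) (t : (H →L[ℂ] H) → H →L[ℂ] H) (a : H →L[ℂ] H) :
    H →L[ℂ] H :=
  (2 * (‖a‖ + 1)) • t ((2 * (‖a‖ + 1))⁻¹ • (a + (‖a‖ + 1) • u)) - (‖a‖ + 1) • u

theorem smul_mem_effectsIn {N : Submodule ℝ (H →L[ℂ] H)} {a : H →L[ℂ] H} (ha : a ∈ effectsIn N)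
    {r : ℝ} (h0 : 0 ≤ r) (h1 : r ≤ 1) : r • a ∈ effectsIn N :=
  ⟨N.smul_mem r ha.1, smul_nonneg h0 ha.2.1,
    ((smul_le_smul_of_nonneg_right h1 ha.2.1).trans_eq (one_smul ℝ a)).trans ha.2.2⟩

namespace IsUnitalAdditiveOn

variable {N : Submodule ℝ (H →L[ℂ] H)} {u : H →L[ℂ] H} {t : (H →L[ℂ] H) → H →L[ℂ] H}
  (ht : IsUnitalAdditiveOn N u t)
include ht

theorem mono {a b : H →L[ℂ] H} (ha : a ∈ effectsIn N) (hb : b ∈ effectsIn N) (hab : a ≤ b) :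
    t a ≤ t b := by
  have hc : b - a ∈ effectsIn N :=
    ⟨N.sub_mem hb.1 ha.1, sub_nonneg.2 hab, (sub_le_self _ ha.2.1).trans hb.2.2⟩
  have h := ht.map_add a ha _ hc (by rwa [add_sub_cancel])
  rw [add_sub_cancel] at h
  rw [h]
  exact le_add_of_nonneg_right (ht.map_mem _ hc).2.1

theorem map_natCast_smul {a : H →L[ℂ] H} (ha : a ∈ effectsIn N) (k : ℕ)
    (hk : ((k : ℝ) + 1) • a ∈ effectsIn N) :
    t (((k : ℝ) + 1) • a) = ((k : ℝ) + 1) • t a := by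
  induction k with
  | zero => simp
  | succ k ih =>
    rw [Nat.cast_succ, add_smul _ (1 : ℝ), one_smul] at hk ⊢
    have hk' : ((k : ℝ) + 1) • a ∈ effectsIn N :=
      ⟨N.smul_mem _ ha.1, smul_nonneg (by positivity) ha.2.1,
        (le_add_of_nonneg_right ha.2.1).trans hk.2.2⟩
    rw [ht.map_add _ hk' _ ha hk, ih hk', add_smul ((k : ℝ) + 1) (1 : ℝ), one_smul]

/-- Approximate r from below by ⌊r (n + 1)⌋ / (n + 1), where additivity gives homogeneity, and use
monotonicity. The reverse inequality follows by treating 1 - r the same way. -/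
theorem smul_le_map_smul {a : H →L[ℂ] H} (ha : a ∈ effectsIn N) {r : ℝ} (h0 : 0 ≤ r)
    (h1 : r ≤ 1) : r • t a ≤ t (r • a) := by
  have hta := ht.map_mem a ha
  have key : ∀ n : ℕ, (r - ((n : ℝ) + 1)⁻¹) • t a ≤ t (r • a) := by
    intro n
    have hn : (0 : ℝ) < (n : ℝ) + 1 := by positivity
    have hfl := Nat.lt_floor_add_one (r * ((n : ℝ) + 1))
    have hfl' := Nat.floor_le (mul_nonneg h0 hn.le)
    have hra := smul_mem_effectsIn ha h0 h1
    rcases Nat.eq_zero_or_pos ⌊r * ((n : ℝ) + 1)⌋₊ with hk | hk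
    · rw [hk, Nat.cast_zero, zero_add] at hfl
      refine le_trans ?_ (ht.map_mem _ hra).2.1
      refine smul_nonpos_of_nonpos_of_nonneg ?_ hta.2.1
      rw [sub_nonpos, ← one_div, le_div_iff₀ hn]
      exact hfl.le
    · obtain ⟨k, hk⟩ := Nat.exists_eq_add_of_lt hk
      rw [zero_add] at hk
      rw [hk, Nat.cast_succ] at hfl hfl'
      have hx := smul_mem_effectsIn ha (inv_nonneg.2 hn.le)
        (inv_le_one_of_one_le₀ (by linarith [Nat.cast_nonneg (α := ℝ) n]))
      have hx1 := ht.map_natCast_smul hx n (by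
        rwa [smul_smul, mul_inv_cancel₀ hn.ne', one_smul])
      rw [smul_smul, mul_inv_cancel₀ hn.ne', one_smul] at hx1
      have hle : ((k : ℝ) + 1) • ((n : ℝ) + 1)⁻¹ • a ≤ r • a := by
        rw [smul_smul]
        refine smul_le_smul_of_nonneg_right ?_ ha.2.1
        rwa [← div_eq_mul_inv, div_le_iff₀ hn]
      have hkx : ((k : ℝ) + 1) • ((n : ℝ) + 1)⁻¹ • a ∈ effectsIn N :=
        ⟨N.smul_mem _ hx.1, smul_nonneg (by positivity) hx.2.1, hle.trans hra.2.2⟩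
      have h3 := ht.mono hkx hra hle
      rw [ht.map_natCast_smul hx k hkx] at h3
      refine le_trans ?_ h3
      rw [hx1, smul_smul]
      refine smul_le_smul_of_nonneg_right ?_ (ht.map_mem _ hx).2.1
      rw [sub_mul, inv_mul_cancel₀ hn.ne']
      linarith
  refine le_of_tendsto_apply (l := atTop) (Eventually.of_forall key) fun x => ?_
  have h1 : Tendsto (fun n : ℕ => ((n : ℝ) + 1)⁻¹) atTop (𝓝 0) := by
    simpa [one_div] using tendsto_one_div_add_atTop_nhds_zero_nat (𝕜 := ℝ)
  simpa using (h1.const_sub r).smul_const (t a x)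

theorem map_smul {a : H →L[ℂ] H} (ha : a ∈ effectsIn N) {r : ℝ} (h0 : 0 ≤ r) (h1 : r ≤ 1) :
    t (r • a) = r • t a := by
  refine le_antisymm ?_ (ht.smul_le_map_smul ha h0 h1)
  have h2 := ht.smul_le_map_smul ha (sub_nonneg.2 h1) (sub_le_self 1 h0)
  have hsum : r • a + (1 - r) • a = a := by rw [← add_smul, add_sub_cancel, one_smul]
  have h3 := ht.map_add _ (smul_mem_effectsIn ha h0 h1) _
    (smul_mem_effectsIn ha (sub_nonneg.2 h1) (sub_le_self 1 h0)) (by rwa [hsum])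
  rw [hsum] at h3
  calc t (r • a) = t a - t ((1 - r) • a) := by rw [h3, add_sub_cancel_right]
    _ ≤ t a - (1 - r) • t a := sub_le_sub_left h2 _
    _ = r • t a := by module

variable (hN : IsMonotoneClosedJordan N u)
include hN

theorem map_affine {a : H →L[ℂ] H} (ha : a ∈ effectsIn N) {r s : ℝ} (hr : 0 ≤ r) (hs : 0 ≤ s)
    (hrs : r + s ≤ 1) : t (r • a + s • u) = r • t a + s • u := by
  have hu := hN.unit_mem_effectsIn
  have h1 := smul_mem_effectsIn ha hr (by linarith)
  have h2 := smul_mem_effectsIn hu hs (by linarith)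
  have h3 : r • a + s • u ≤ u := by
    calc r • a + s • u ≤ r • u + s • u := by
          gcongr
          exact hN.le_unit ha.1 ha.2.2
      _ = (r + s) • u := (add_smul _ _ _).symm
      _ ≤ (1 : ℝ) • u := smul_le_smul_of_nonneg_right hrs hu.2.1
      _ = u := one_smul _ _
  rw [ht.map_add _ h1 _ h2 ⟨N.add_mem h1.1 h2.1, add_nonneg h1.2.1 h2.2.1, h3.trans hu.2.2⟩,
    ht.map_smul ha hr (by linarith), ht.map_smul hu hs (by linarith), ht.map_unit]

/-- The extension does not depend on the radius used to squeeze a into the effects, so a common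
radius can be chosen when several elements are compared. -/
theorem affine_eq {a : H →L[ℂ] H} (ha : a ∈ N) {r s : ℝ} (hr : 0 < r) (har : ‖a‖ ≤ r)
    (hrs : r ≤ s) :
    (2 * s) • t ((2 * s)⁻¹ • (a + s • u)) - s • u =
      (2 * r) • t ((2 * r)⁻¹ • (a + r • u)) - r • u := by
  have hs := hr.trans_le hrs
  have h1 : (2 * s)⁻¹ • (a + s • u) =
      (r / s) • ((2 * r)⁻¹ • (a + r • u)) + ((s - r) / (2 * s)) • u := by
    have e1 : r / s * (2 * r)⁻¹ = (2 * s)⁻¹ := by field_simp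
    have e2 : (2 * s)⁻¹ * s = (2 * s)⁻¹ * r + (s - r) / (2 * s) := by field_simp; ring
    rw [smul_smul, e1, smul_add, smul_add, smul_smul, smul_smul, e2, add_smul, add_assoc]
  have h2 : r / s + (s - r) / (2 * s) ≤ 1 := by
    rw [div_add_div _ _ hs.ne' (by positivity), div_le_one (by positivity)]
    nlinarith
  rw [h1, ht.map_affine hN (hN.affine_mem_effectsIn ha hr har) (by positivity)
    (div_nonneg (sub_nonneg.2 hrs) (by positivity)) h2]
  have e1 : 2 * s * (r / s) = 2 * r := by field_simp
  have e2 : 2 * s * ((s - r) / (2 * s)) = s - r := by field_simp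
  rw [smul_add, smul_smul, smul_smul, e1, e2]
  module

theorem linearExtension_eq {a : H →L[ℂ] H} (ha : a ∈ N) {r : ℝ} (hr : 0 < r) (har : ‖a‖ ≤ r) :
    linearExtension u t a = (2 * r) • t ((2 * r)⁻¹ • (a + r • u)) - r • u := by
  have hpos : 0 < ‖a‖ + 1 := by positivity
  rcases le_total r (‖a‖ + 1) with h | h
  · exact ht.affine_eq hN ha hr har h
  · exact (ht.affine_eq hN ha hpos (by linarith) h).symm

theorem linearExtension_eq_of_effect {a : H →L[ℂ] H} (ha : a ∈ effectsIn N) :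
    linearExtension u t a = t a := by
  have hr : (1 : ℝ) ≤ ‖a‖ + 1 := by linarith [norm_nonneg a]
  have hr0 : 0 < ‖a‖ + 1 := by positivity
  rw [ht.linearExtension_eq hN ha.1 hr0 (by linarith)]
  have e : (2 * (‖a‖ + 1))⁻¹ * (‖a‖ + 1) = 1 / 2 := by field_simp
  have h1 : (2 * (‖a‖ + 1))⁻¹ ≤ 1 / 2 := by
    rw [one_div]
    exact inv_anti₀ two_pos (by linarith)
  rw [smul_add, smul_smul, e, ht.map_affine hN ha (by positivity) (by norm_num) (by linarith),
    smul_add, smul_smul, smul_smul, mul_inv_cancel₀ (by positivity), one_smul]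
  module

theorem isPositiveUnitalOn_linearExtension : IsPositiveUnitalOn N u (linearExtension u t) := by
  have hu := hN.unit_mem_effectsIn
  have hneg : ∀ a ∈ N, linearExtension u t (-a) = -linearExtension u t a := by
    intro a ha
    have hr0 : 0 < ‖a‖ + 1 := by positivity
    rw [ht.linearExtension_eq hN ha hr0 (by linarith),
      ht.linearExtension_eq hN (N.neg_mem ha) hr0 (by rw [norm_neg]; linarith)]
    set r := ‖a‖ + 1 with hr
    have h1 := hN.affine_mem_effectsIn ha hr0 (by linarith)
    have h2 := hN.affine_mem_effectsIn (N.neg_mem ha) hr0 (by rw [norm_neg]; linarith)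
    have h3 : (2 * r)⁻¹ • (-a + r • u) + (2 * r)⁻¹ • (a + r • u) = u := by
      rw [← smul_add, add_add_add_comm, neg_add_cancel, zero_add, ← two_smul ℝ, smul_smul,
        smul_smul, mul_assoc, inv_mul_cancel₀ (by positivity), one_smul]
    have h4 := ht.map_add _ h2 _ h1 (by rwa [h3])
    rw [h3, ht.map_unit] at h4
    rw [eq_sub_of_add_eq h4.symm]
    module
  have hpos : ∀ c : ℝ, 0 < c → ∀ a ∈ N, linearExtension u t (c • a) =
      c • linearExtension u t a := by
    intro c hc a ha
    have hr0 : 0 < ‖a‖ + 1 := by positivity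
    rw [ht.linearExtension_eq hN ha hr0 (by linarith),
      ht.linearExtension_eq hN (N.smul_mem c ha) (r := c * (‖a‖ + 1)) (by positivity)
        (by rw [norm_smul, Real.norm_of_nonneg hc.le]; gcongr; linarith)]
    have h1 : (2 * (c * (‖a‖ + 1)))⁻¹ • (c • a + (c * (‖a‖ + 1)) • u) =
        (2 * (‖a‖ + 1))⁻¹ • (a + (‖a‖ + 1) • u) := by
      rw [mul_smul c, ← smul_add, smul_smul]
      congr 1
      field_simp
    rw [h1]
    module
  refine ⟨fun a ha => ?_, fun a ha b hb => ?_, fun c a ha => ?_, fun a ha ha0 => ?_, ?_⟩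
  · have hr0 : 0 < ‖a‖ + 1 := by positivity
    exact N.sub_mem (N.smul_mem _ (ht.map_mem _
      (hN.affine_mem_effectsIn ha hr0 (by linarith))).1) (N.smul_mem _ hN.unit_mem)
  · set r := ‖a‖ + ‖b‖ + 1 with hr
    have hr0 : 0 < r := by positivity
    have ha' : ‖a‖ ≤ r := by linarith [norm_nonneg b]
    have hb' : ‖b‖ ≤ r := by linarith [norm_nonneg a]
    rw [ht.linearExtension_eq hN ha hr0 ha', ht.linearExtension_eq hN hb hr0 hb',
      ht.linearExtension_eq hN (N.add_mem ha hb) (r := 2 * r) (by positivity)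
        ((norm_add_le a b).trans (by linarith))]
    have h1 := hN.affine_mem_effectsIn ha hr0 ha'
    have h2 := hN.affine_mem_effectsIn hb hr0 hb'
    have h3 := midpoint_mem_effectsIn h1 h2
    -- At radius 2r the squeezed sum is the midpoint of the squeezed summands, so additivity on
    -- effects applies.
    have h4 : (2 * (2 * r))⁻¹ • (a + b + (2 * r) • u) =
        (1 / 2 : ℝ) • ((2 * r)⁻¹ • (a + r • u)) + (1 / 2 : ℝ) • ((2 * r)⁻¹ • (b + r • u)) := by
      rw [← smul_add, ← smul_add, smul_smul]
      have : (2 * (2 * r))⁻¹ = 1 / 2 * (2 * r)⁻¹ := by field_simp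
      rw [this]
      congr 1
      module
    rw [smul_add] at h3
    rw [h4, ht.map_add _ (smul_mem_effectsIn h1 (by norm_num) (by norm_num)) _
      (smul_mem_effectsIn h2 (by norm_num) (by norm_num)) h3,
      ht.map_smul h1 (by norm_num) (by norm_num), ht.map_smul h2 (by norm_num) (by norm_num)]
    module
  · rcases lt_trichotomy c 0 with hc | rfl | hc
    · have h1 := hpos (-c) (neg_pos.2 hc) _ (N.neg_mem ha)
      rwa [hneg a ha, neg_smul_neg, neg_smul_neg] at h1
    · have h1 := hneg 0 N.zero_mem
      rw [neg_zero, eq_neg_iff_add_eq_zero, ← two_smul ℝ] at h1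
      simpa using h1
    · exact hpos c hc a ha
  · have hr : 0 < (‖a‖ + 1)⁻¹ := by positivity
    have ha0' := smul_nonneg hr.le ha0
    have heff : (‖a‖ + 1)⁻¹ • a ∈ effectsIn N := by
      refine ⟨N.smul_mem _ ha, ha0', (CStarAlgebra.norm_le_one_iff_of_nonneg _ ha0').1 ?_⟩
      rw [norm_smul, Real.norm_of_nonneg hr.le]
      exact (inv_mul_le_one₀ (by positivity)).2 (by linarith)
    have h1 := hpos (‖a‖ + 1) (by positivity) _ heff.1
    rw [smul_smul, mul_inv_cancel₀ (by positivity), one_smul,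
      ht.linearExtension_eq_of_effect hN heff] at h1
    rw [h1]
    exact smul_nonneg (by positivity) (ht.map_mem _ heff).2.1
  · rw [ht.linearExtension_eq_of_effect hN hu, ht.map_unit]

end IsUnitalAdditiveOn

end Extension

/-! ### Passing between maps of effects and linear maps -/

namespace JWAlgebra

section EffectMaps

variable {H : Type*} [NormedAddCommGroup H] [InnerProductSpace ℂ H] [CompleteSpace H]
  {J : JWAlgebra H}

/-- The suprema of directed sets of effects are the same in `E(J)` and among all operators. -/
theorem isLUB_coe_image_iff {D : Set J.Effect} (hne : D.Nonempty)
    (hdir : DirectedOn (· ≤ ·) D) {a : J.Effect} :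
    IsLUB ((fun d : J.Effect => (d : H →L[ℂ] H)) '' D) (a : H →L[ℂ] H) ↔ IsLUB D a := by
  have hsub : (fun d : J.Effect => (d : H →L[ℂ] H)) '' D ⊆ effectsIn J.toSubmodule := by
    rintro _ ⟨d, -, rfl⟩
    exact d.2
  have hdir' : DirectedOn (· ≤ ·) ((fun d : J.Effect => (d : H →L[ℂ] H)) '' D) := by
    rintro _ ⟨d, hd, rfl⟩ _ ⟨e, he, rfl⟩
    obtain ⟨f, hf, hdf, hef⟩ := hdir d hd e he
    exact ⟨f, ⟨f, hf, rfl⟩, hdf, hef⟩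
  have hmp : ∀ b : J.Effect,
      IsLUB ((fun d : J.Effect => (d : H →L[ℂ] H)) '' D) (b : H →L[ℂ] H) → IsLUB D b := by
    intro b hb
    refine ⟨fun d hd => hb.1 ⟨d, hd, rfl⟩, fun c hc => hb.2 ?_⟩
    rintro _ ⟨d, hd, rfl⟩
    exact hc hd
  refine ⟨hmp a, fun ha => ?_⟩
  -- The supremum among operators exists and is itself an effect of J, so it must be the supremum in
  -- E(J).
  obtain ⟨s, hs, -⟩ := exists_isLUB_tendsto (hne.image _) hdir' fun d hd => (hsub hd).2
  have hsJ := J.isMonotoneClosedJordan.sup_mem_effectsIn hsub (hne.image _) hdir' hs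
  have := ha.unique (hmp ⟨s, hsJ⟩ hs)
  rw [this]
  exact hs

/-- A map of effects, extended by zero to all operators. -/
noncomputable def extendByZero (τ : J.Effect → J.Effect) (a : H →L[ℂ] H) : H →L[ℂ] H :=
  open Classical in if h : a ∈ J.effects then (τ ⟨a, h⟩ : H →L[ℂ] H) else 0

theorem extendByZero_coe (τ : J.Effect → J.Effect) (a : J.Effect) :
    extendByZero τ (a : H →L[ℂ] H) = τ a := by
  rw [extendByZero, dif_pos a.2]

theorem IsUnitalAdditive.isUnitalAdditiveOn {τ : J.Effect → J.Effect} (hτ : IsUnitalAdditive τ) :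
    IsUnitalAdditiveOn J.toSubmodule J.unit (extendByZero τ) where
  map_mem a ha := by
    rw [extendByZero_coe τ ⟨a, ha⟩]
    exact (τ ⟨a, ha⟩).2
  map_add a ha b hb hab := by
    rw [extendByZero_coe τ ⟨a, ha⟩, extendByZero_coe τ ⟨b, hb⟩, extendByZero_coe τ ⟨a + b, hab⟩]
    exact hτ.map_add _ _ _ rfl
  map_unit := by
    have h := extendByZero_coe τ J.one
    rw [hτ.map_one] at h
    exact h

theorem isNormal_iff_isNormalOn {ψ : J.Effect → J.Effect} {T : (H →L[ℂ] H) → H →L[ℂ] H}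
    (hT : IsPositiveUnitalOn J.toSubmodule J.unit T)
    (h : ∀ a : J.Effect, (ψ a : H →L[ℂ] H) = T a) :
    IsNormal ψ ↔ IsNormalOn J.toSubmodule T := by
  have hmono : Monotone ψ := fun a b hab => by
    have := hT.mono a.2.1 b.2.1 hab
    rw [← h, ← h] at this
    exact this
  have himage : ∀ D : Set J.Effect, (fun d : J.Effect => (d : H →L[ℂ] H)) '' (ψ '' D) =
      T '' ((fun d : J.Effect => (d : H →L[ℂ] H)) '' D) := by
    intro D
    simp only [Set.image_image, h]
  have hdirψ : ∀ D : Set J.Effect, DirectedOn (· ≤ ·) D → DirectedOn (· ≤ ·) (ψ '' D) := by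
    rintro D hdir _ ⟨d, hd, rfl⟩ _ ⟨e, he, rfl⟩
    obtain ⟨f, hf, hdf, hef⟩ := hdir d hd e he
    exact ⟨ψ f, ⟨f, hf, rfl⟩, hmono hdf, hmono hef⟩
  constructor
  · intro hψ D hD hne hdir s hs
    have hsJ := J.isMonotoneClosedJordan.sup_mem_effectsIn hD hne hdir hs
    have hDD : (fun d : J.Effect => (d : H →L[ℂ] H)) ''
        {d : J.Effect | (d : H →L[ℂ] H) ∈ D} = D := by
      ext x
      constructor
      · rintro ⟨d, hd, rfl⟩
        exact hd
      · exact fun hx => ⟨⟨x, hD hx⟩, hx, rfl⟩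
    have hne' : {d : J.Effect | (d : H →L[ℂ] H) ∈ D}.Nonempty := by
      rw [← hDD] at hne
      exact hne.of_image
    have hdir' : DirectedOn (· ≤ ·) {d : J.Effect | (d : H →L[ℂ] H) ∈ D} := by
      intro d hd e he
      obtain ⟨f, hf, hdf, hef⟩ := hdir d hd e he
      exact ⟨⟨f, hD hf⟩, hf, hdf, hef⟩
    have h1 := hψ _ hne' hdir' ⟨s, hsJ⟩ ((isLUB_coe_image_iff hne' hdir').1 (by rwa [hDD]))
    rw [← isLUB_coe_image_iff (hne'.image _) (hdirψ _ hdir'), himage, hDD, h] at h1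
    exact h1
  · intro hTn D hne hdir a ha
    rw [← isLUB_coe_image_iff (hne.image _) (hdirψ _ hdir), himage, h]
    refine hTn _ ?_ (hne.image _) ?_ _ ((isLUB_coe_image_iff hne hdir).2 ha)
    · rintro _ ⟨d, -, rfl⟩
      exact d.2
    · rintro _ ⟨d, hd, rfl⟩ _ ⟨e, he, rfl⟩
      obtain ⟨f, hf, hdf, hef⟩ := hdir d hd e he
      exact ⟨f, ⟨f, hf, rfl⟩, hdf, hef⟩

/-- A positive unital map of `J` restricted to the effects. -/
def restrictEffects {T : (H →L[ℂ] H) → H →L[ℂ] H}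
    (hT : IsPositiveUnitalOn J.toSubmodule J.unit T) (a : J.Effect) : J.Effect :=
  ⟨T a, hT.map_mem_effectsIn J.isMonotoneClosedJordan a.2⟩

theorem isUnitalAdditive_restrictEffects {T : (H →L[ℂ] H) → H →L[ℂ] H}
    (hT : IsPositiveUnitalOn J.toSubmodule J.unit T) : IsUnitalAdditive (restrictEffects hT) where
  map_one := Subtype.ext hT.map_unit
  map_add a b c h := by
    change T c = T a + T b
    rw [h, hT.map_add _ a.2.1 _ b.2.1]

theorem exists_linear_extension {τ : J.Effect → J.Effect} (hτ : IsStateOperator τ)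
    (hnormal : IsNormal τ) :
    ∃ T, IsPositiveUnitalOn J.toSubmodule J.unit T ∧ (∀ a : J.Effect, (τ a : H →L[ℂ] H) = T a) ∧
      (∀ a ∈ J.toSubmodule, T (T a) = T a) ∧ IsNormalOn J.toSubmodule T := by
  have hJ := J.isMonotoneClosedJordan
  have ht := hτ.toIsUnitalAdditive.isUnitalAdditiveOn
  have hT := ht.isPositiveUnitalOn_linearExtension hJ
  have hτT : ∀ a : J.Effect, (τ a : H →L[ℂ] H) = linearExtension J.unit (extendByZero τ) a :=
    fun a => by rw [ht.linearExtension_eq_of_effect hJ a.2, extendByZero_coe]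
  refine ⟨_, hT, hτT, fun a ha => ?_, (isNormal_iff_isNormalOn hT hτT).1 hnormal⟩
  have hr : 0 < ‖a‖ + 1 := by positivity
  have he := hJ.affine_mem_effectsIn ha hr (by linarith)
  set r := ‖a‖ + 1
  set e := (2 * r)⁻¹ • (a + r • J.unit) with hedef
  have hae : a = (2 * r) • e - r • J.unit := by
    rw [hedef, smul_smul, mul_inv_cancel₀ (by positivity), one_smul, add_sub_cancel_right]
  have hidem := congrArg Subtype.val (hτ.idem ⟨e, he⟩)
  rw [hτT, hτT] at hidem
  have heJ := he.1
  have hu := J.unit_mem'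
  have hTe := hT.map_mem e heJ
  have key : ∀ x ∈ J.toSubmodule, linearExtension J.unit (extendByZero τ)
      ((2 * r) • x - r • J.unit) =
        (2 * r) • linearExtension J.unit (extendByZero τ) x - r • J.unit := by
    intro x hx
    rw [hT.map_sub (J.toSubmodule.smul_mem _ hx) (J.toSubmodule.smul_mem _ hu),
      hT.map_smul _ _ hx, hT.map_smul _ _ hu, hT.map_unit]
  rw [hae, key e heJ, key _ hTe]
  exact congrArg (fun y => (2 * r) • y - r • J.unit) hidem

end EffectMaps

end JWAlgebra

end Preliminaries

/-! ### The decomposition of a normal state operator -/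

theorem mainTheorem4 {H : Type*} [NormedAddCommGroup H] [InnerProductSpace ℂ H] [CompleteSpace H]
    (J : JWAlgebra H) (τ : J.Effect → J.Effect)
    (hτ : JWAlgebra.IsStateOperator τ) (hnormal : JWAlgebra.IsNormal τ) :
    JWAlgebra.IsSubJWEffectAlgebra (JWAlgebra.eqSet τ) ∧
    ∃ μ : J.Effect → J.Effect,
      JWAlgebra.IsConditionalExpectation μ ∧ JWAlgebra.IsFaithful μ ∧ JWAlgebra.IsNormal μ ∧
      Set.range μ = JWAlgebra.eqSet τ ∧
      ∃ N : JWAlgebra H, JWAlgebra.IsEffectsOf (JWAlgebra.eqSet τ) N ∧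
        ∃ φ : N.Effect → N.Effect,
          JWAlgebra.IsJordanStateOperator φ ∧ JWAlgebra.IsNormal φ ∧
          ∀ (a : J.Effect) (b : N.Effect), (b : H →L[ℂ] H) = μ a →
            (φ b : H →L[ℂ] H) = τ a := by
  have hJ := J.isMonotoneClosedJordan
  obtain ⟨T, hT, hτT, hidem, hTn⟩ := JWAlgebra.exists_linear_extension hτ hnormal
  obtain ⟨p, hp⟩ := hT.exists_isNullProjection hJ hidem hTn
  have hM := hp.isFaithfulProjectionOn_faithfulPart hJ
  have hMn := hp.isNormalOn_faithfulPart hJ hTn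
  have hfix := hM.isMonotoneClosedJordan_fixedPoints hJ hMn
  set M := faithfulPart J.unit p T with hMdef
  have heq : ∀ a : J.Effect, a ∈ JWAlgebra.eqSet τ ↔ M a = a := by
    intro a
    rw [hMdef, hp.faithfulPart_eq_self_iff hJ a.2.1]
    change τ (JWAlgebra.sq a) = τ (JWAlgebra.sq (τ a)) ↔ _
    rw [← Subtype.coe_inj, hτT, hτT]
    change T ((a : H →L[ℂ] H) ^ 2) = T ((τ a : H →L[ℂ] H) ^ 2) ↔ _
    rw [hτT, pow_two, pow_two]
  have hcl := hfix.isClosed_wot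
  have heff : JWAlgebra.IsEffectsOf (JWAlgebra.eqSet τ) (hfix.toJWAlgebra hcl) := by
    refine ⟨fun a ha => ha.1, rfl, fun a => ?_⟩
    rw [heq]
    exact ⟨fun h => ⟨⟨a.2.1, h⟩, a.2.2⟩, fun h => h.1.2⟩
  -- T maps into the fixed points of M because its values are fixed by T, hence by M.
  have hTfix : IsPositiveUnitalOn hM.fixedPoints J.unit T :=
    { map_mem := fun a ha => ⟨hT.map_mem a ha.1,
        hp.faithfulPart_eq_of_fixed hJ (hT.map_mem a ha.1) (hidem a ha.1)⟩
      map_add := fun a ha b hb => hT.map_add a ha.1 b hb.1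
      map_smul := fun c a ha => hT.map_smul c a ha.1
      map_nonneg := fun a ha => hT.map_nonneg a ha.1
      map_unit := hT.map_unit }
  have hTfixn : IsNormalOn hM.fixedPoints T := fun D hD =>
    hTn D fun d hd => ⟨(hD hd).1.1, (hD hd).2⟩
  refine ⟨⟨⟨?_, ?_, ?_⟩, ?_, _, heff⟩, JWAlgebra.restrictEffects hM.toIsPositiveUnitalOn,
    ⟨JWAlgebra.isUnitalAdditive_restrictEffects _, ?_⟩, ?_, ?_, ?_, hfix.toJWAlgebra hcl, heff,
    JWAlgebra.restrictEffects (J := hfix.toJWAlgebra hcl) hTfix,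
    ⟨JWAlgebra.isUnitalAdditive_restrictEffects (J := hfix.toJWAlgebra hcl) hTfix, ?_⟩,
    (JWAlgebra.isNormal_iff_isNormalOn (J := hfix.toJWAlgebra hcl) hTfix fun _ => rfl).2 hTfixn, ?_⟩
  · exact (heq _).2 hM.map_unit
  · intro a b hab ha
    rw [heq] at ha ⊢
    rw [eq_sub_of_add_eq' hab, hM.map_sub hJ.unit_mem a.2.1, hM.map_unit, ha]
  · intro a b c hc ha hb
    rw [heq] at ha hb ⊢
    rw [hc, hM.map_add _ a.2.1 _ b.2.1, ha, hb]
  · intro a ha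
    rw [heq] at ha ⊢
    change M ((a : H →L[ℂ] H) ^ 2) = (a : H →L[ℂ] H) ^ 2
    rw [pow_two, hM.map_mul_self hJ a.2.1 ha]
  · intro a b
    exact Subtype.ext (hM.map_conj hJ (hM.map_mem a a.2.1) (hM.idem a a.2.1) b.2.1)
  · exact fun a ha => hM.faithful a a.2.1 a.2.2.1 ha
  · exact (JWAlgebra.isNormal_iff_isNormalOn hM.toIsPositiveUnitalOn fun _ => rfl).2 hMn
  · ext a
    rw [heq]
    constructor
    · rintro ⟨b, rfl⟩
      exact hM.idem b b.2.1
    · exact fun h => ⟨a, Subtype.ext h⟩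
  · intro a
    refine Subtype.ext ?_
    change T ((a : H →L[ℂ] H) ^ 2) = T (T a ^ 2)
    -- The Jordan state identity at a is equivalent to a being fixed by M, which is the membership
    -- condition of the domain.
    rw [pow_two, pow_two, ← hp.faithfulPart_eq_self_iff hJ a.2.1.1]
    exact a.2.1.2
  · intro a b hb
    change T b = τ a
    rw [hb, hτT]
    exact hp.map_faithfulPart hJ a.2.1
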